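/- All graphs are finite, undirected and simple. A graph is \emph{planar} if it can be drawn in the plane without crossings: distinct vertices are represented by distinct points of $\mathbb{R}^2$, each edge by a simple continuous arc joining the points of its two ends and containing no other vertex point, and arcs of different edges are disjoint except possibly at common ends. A \emph{distance-2 coloring} of a graph is an assignment of colors to its vertices in which any two distinct vertices joined by a path of length one or two (that is, any two vertices that are adjacent or are distinct and have a common neighbor) receive distinct colors. \textbf{Theorem (Wegner).} Every planar graph in which no vertex has more than three neighbors admits a distance-2 coloring with at most $8$ colors. -/

import Mathlib

namespace SimpleGraph

/-- A drawing of a graph in the Euclidean plane without crossings: distinct vertices are distinct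
points, every edge is a simple continuous arc joining the points of its two ends, no arc passes
through the point of a vertex in its interior, and the interiors of the arcs of different edges are
disjoint. -/
structure PlanarEmbedding {V : Type*} (G : SimpleGraph V) where
  /-- The point that represents a vertex. -/
  point : V → EuclideanSpace ℝ (Fin 2)
  /-- The arc that represents an edge, parametrized by the unit interval. -/
  arc : G.edgeSet → C(unitInterval, EuclideanSpace ℝ (Fin 2))
  point_injective : Function.Injective point
  arc_injective : ∀ e : G.edgeSet, Function.Injective (arc e)
  /-- As an unordered pair, the ends of the arc of `e` are the points of the ends of `e`. -/
  arc_ends : ∀ e : G.edgeSet, s(arc e 0, arc e 1) = Sym2.map point (e : Sym2 V)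
  arc_ne_point : ∀ (e : G.edgeSet), ∀ t ∈ Set.Ioo (0 : unitInterval) 1, ∀ v : V,
    arc e t ≠ point v
  arc_disjoint : ∀ e f : G.edgeSet, e ≠ f → ∀ s ∈ Set.Ioo (0 : unitInterval) 1,
    ∀ t ∈ Set.Ioo (0 : unitInterval) 1, arc e s ≠ arc f t

/-- A graph is planar if it can be drawn in the plane without crossings. -/
def IsPlanar {V : Type*} (G : SimpleGraph V) : Prop :=
  Nonempty G.PlanarEmbedding

/-- Neighbors of second order: distinct vertices `v`, `w` joined by a path `v`, `u`, `w` of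
length two. -/
def SecondOrderAdj {V : Type*} (G : SimpleGraph V) (v w : V) : Prop :=
  v ≠ w ∧ ∃ u : V, G.Adj v u ∧ G.Adj u w

/-- A distance-2 coloring: neighbors of first or second order receive distinct colors. -/
def IsDistanceTwoColoring {V α : Type*} (G : SimpleGraph V) (c : V → α) : Prop :=
  ∀ v w : V, G.Adj v w ∨ G.SecondOrderAdj v w → c v ≠ c w

end SimpleGraph

/-! Planarity is used only to exclude the Petersen graph. What is really proved, in
`Connected.exists_coloring`, is that the square of a finite connected graph of maximum degree at
most three that does not contain the Petersen graph can be colored with eight colors.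

A vertex has at most 9 neighbors in the square. Let S be a set of vertices that contains an edge.
Outside S the square is colored greedily towards that edge (`exists_partial_coloring`): the next two
vertices on the way are still uncolored, so at most 7 colors are forbidden. A vertex of S with s
square-neighbors in S then keeps at least s - 1 of the eight colors. By the Alon–Tarsi method, the
coloring extends to S if the product of X i - X j over the edges of the square within S has a
nonzero coefficient at a monomial whose exponents are smaller than the list sizes, for example at
most s - 2 (`exists_coloring_of_signedCount`).

Such a set S is found at a vertex of degree at most two or, in a cubic graph, at a shortest cycle.
If the cycle has length at least seven, two pendant neighbors are added, and a transfer recursion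
shows that the relevant coefficient has period three in the length, so that three computations
suffice. For length six the cycle alone works. Lengths three, four and five need a discussion of how
the pendant neighbors are joined; the only obstruction that remains is the Petersen graph, in length
five.

The Petersen graph contains a subdivision of `K₃,₃`. That `K₃,₃` is not planar follows from a parity
argument with continuous logarithms of differences of points on independent edges
(`not_exists_disjoint_paths`). -/

/-! ### Coefficients of graph polynomials and list colorings -/

open MvPolynomial in
/-- The product of `X i - X j` over a list of pairs, in the variables with index below `M`; the
other variables are replaced by zero. -/
noncomputable def pairPoly (M : ℕ) : List (ℕ × ℕ) → MvPolynomial (Fin M) ℤ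
  | [] => 1
  | e :: es => ((if h : e.1 < M then X ⟨e.1, h⟩ else 0) - (if h : e.2 < M then X ⟨e.2, h⟩ else 0)) *
      pairPoly M es

open Classical in
/-- The coefficient of the monomial with exponents `t` in the product of `X i - X j` over a list of
pairs. -/
noncomputable def signedCount : List (ℕ × ℕ) → (ℕ → ℕ) → ℤ
  | [], t => if ∀ i, t i = 0 then 1 else 0
  | e :: es, t =>
      (if t e.1 = 0 then 0 else signedCount es (Function.update t e.1 (t e.1 - 1))) -
      (if t e.2 = 0 then 0 else signedCount es (Function.update t e.2 (t e.2 - 1)))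

/-- Decrease the entry at a given position of a list by one, if it is positive. -/
def decreaseAt : List ℕ → ℕ → Option (List ℕ)
  | [], _ => none
  | 0 :: _, 0 => none
  | (a + 1) :: l, 0 => some (a :: l)
  | a :: l, i + 1 => (decreaseAt l i).map (a :: ·)

/-- A computable version of `signedCount`, with the exponents given by a list. -/
def listCount : List (ℕ × ℕ) → List ℕ → ℤ
  | [], l => bif l.all (· == 0) then 1 else 0
  | e :: es, l =>
      (decreaseAt l e.1).elim 0 (listCount es) - (decreaseAt l e.2).elim 0 (listCount es)

theorem decreaseAt_eq_none {l : List ℕ} {i : ℕ} (h : l.getD i 0 = 0) : decreaseAt l i = none := by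
  induction l generalizing i with
  | nil => rfl
  | cons a l ih =>
    cases i with
    | zero =>
      obtain rfl : a = 0 := h
      rfl
    | succ i => cases a <;> simp [decreaseAt, ih (i := i) (by simpa using h)]

theorem exists_decreaseAt_eq_some {l : List ℕ} {i : ℕ} (h : l.getD i 0 ≠ 0) :
    ∃ l', decreaseAt l i = some l' ∧
      (fun k => l'.getD k 0) = Function.update (fun k => l.getD k 0) i (l.getD i 0 - 1) := by
  induction l generalizing i with
  | nil => simp at h
  | cons a l ih =>
    cases i with
    | zero =>
      obtain ⟨a, rfl⟩ := Nat.exists_eq_succ_of_ne_zero h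
      refine ⟨a :: l, rfl, ?_⟩
      ext k
      cases k <;> simp
    | succ i =>
      obtain ⟨l', hl', he⟩ := ih (i := i) (by simpa using h)
      refine ⟨a :: l', by cases a <;> simp [decreaseAt, hl'], ?_⟩
      ext k
      cases k with
      | zero => simp
      | succ k => simpa [Function.update_apply] using congrFun he k

/-- This transfers evaluations by the kernel to `signedCount`, whose definition decides a condition
on all natural numbers classically. -/
theorem listCount_eq_signedCount (es : List (ℕ × ℕ)) (l : List ℕ) :
    listCount es l = signedCount es (fun k => l.getD k 0) := by
  induction es generalizing l with
  | nil =>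
    have h : l.all (· == 0) = true ↔ ∀ i, l.getD i 0 = 0 := by
      simp only [List.all_eq_true, beq_iff_eq]
      constructor
      · intro h i
        by_cases hi : i < l.length
        · rw [List.getD_eq_getElem _ _ hi]
          exact h _ (List.getElem_mem hi)
        · exact List.getD_eq_default _ _ (not_lt.mp hi)
      · intro h x hx
        obtain ⟨i, hi, rfl⟩ := List.getElem_of_mem hx
        rw [← List.getD_eq_getElem _ 0 hi]
        exact h i
    rw [listCount, signedCount]
    by_cases hl : l.all (· == 0) = true
    · rw [if_pos (h.mp hl), hl, cond_true]
    · rw [if_neg (fun h' => hl (h.mpr h')), Bool.eq_false_iff.mpr hl, cond_false]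
  | cons e es ih =>
    have key : ∀ i, (decreaseAt l i).elim 0 (listCount es) = if l.getD i 0 = 0 then 0 else
        signedCount es (Function.update (fun k => l.getD k 0) i (l.getD i 0 - 1)) := by
      intro i
      split_ifs with h
      · simp [decreaseAt_eq_none h]
      · obtain ⟨l', hl', he⟩ := exists_decreaseAt_eq_some h
        rw [hl', Option.elim_some, ih, he]
    rw [listCount, signedCount, key, key]

open MvPolynomial in
theorem coeff_ite_X_mul (M : ℕ) (p : MvPolynomial (Fin M) ℤ) (i : ℕ) (t : ℕ → ℕ)
    (ht : ∀ k, M ≤ k → t k = 0) :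
    coeff (Finsupp.equivFunOnFinite.symm fun k : Fin M => t k)
      ((if h : i < M then X ⟨i, h⟩ else 0) * p) =
    if t i = 0 then 0 else
      coeff (Finsupp.equivFunOnFinite.symm fun k : Fin M => Function.update t i (t i - 1) k) p := by
  by_cases hi : i < M
  · rw [dif_pos hi, coeff_X_mul']
    by_cases h0 : t i = 0
    · simp [h0]
    · simp only [Finsupp.mem_support_iff, Finsupp.equivFunOnFinite_symm_apply_apply, ne_eq, h0,
        not_false_eq_true, if_true, if_false]
      congr 1
      ext k
      by_cases hk : k = ⟨i, hi⟩
      · subst hk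
        simp
      · have hk' : (k : ℕ) ≠ i := fun h => hk (Fin.ext h)
        simp [Function.update_of_ne hk', Ne.symm hk]
  · simp [hi, ht i (not_lt.mp hi)]

-- The product is expanded one factor at a time. The hypothesis `ht` makes it harmless that
-- variables with index at least `M` are replaced by zero.
open MvPolynomial in
theorem coeff_pairPoly (M : ℕ) (es : List (ℕ × ℕ)) (t : ℕ → ℕ) (ht : ∀ k, M ≤ k → t k = 0) :
    coeff (Finsupp.equivFunOnFinite.symm fun k : Fin M => t k) (pairPoly M es) =
      signedCount es t := by
  induction es generalizing t with
  | nil =>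
    simp only [pairPoly, signedCount, coeff_one]
    congr 1
    simp only [eq_iff_iff]
    constructor
    · intro h i
      by_cases hi : i < M
      · have := DFunLike.congr_fun h ⟨i, hi⟩
        simpa using this.symm
      · exact ht i (not_lt.mp hi)
    · intro h
      ext k
      simp [h]
  | cons e es ih =>
    have hu : ∀ i k, M ≤ k → Function.update t i (t i - 1) k = 0 := by
      intro i k hk
      by_cases h : k = i
      · subst h
        simp [ht k hk]
      · simp [Function.update_of_ne h, ht k hk]
    rw [pairPoly, sub_mul, coeff_sub, coeff_ite_X_mul _ _ _ _ ht, coeff_ite_X_mul _ _ _ _ ht,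
      ih _ (hu _), ih _ (hu _), signedCount]

open MvPolynomial in
theorem isHomogeneous_pairPoly (M : ℕ) (es : List (ℕ × ℕ)) :
    (pairPoly M es).IsHomogeneous es.length := by
  induction es with
  | nil => exact isHomogeneous_one _ _
  | cons e es ih =>
    rw [pairPoly, List.length_cons, add_comm]
    refine IsHomogeneous.mul (IsHomogeneous.sub ?_ ?_) ih <;>
    · split_ifs
      · exact isHomogeneous_X _ _
      · exact isHomogeneous_zero _ _ _

open MvPolynomial in
theorem eval_pairPoly_ne_zero (M : ℕ) (es : List (ℕ × ℕ)) (s : Fin M → ℤ)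
    (h : eval s (pairPoly M es) ≠ 0) (e : ℕ × ℕ) (he : e ∈ es) (h1 : e.1 < M) (h2 : e.2 < M) :
    s ⟨e.1, h1⟩ ≠ s ⟨e.2, h2⟩ := by
  induction es with
  | nil => simp at he
  | cons a es ih =>
    rw [pairPoly, eval_mul] at h
    rcases List.mem_cons.mp he with rfl | he
    · intro heq
      apply left_ne_zero_of_mul h
      simp [h1, h2, heq]
    · exact ih (right_ne_zero_of_mul h) he

/-- The theorem of Alon and Tarsi in polynomial form. -/
theorem exists_list_coloring_of_signedCount_ne_zero {α : Type*} (κ : α → ℤ)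
    (hκ : Function.Injective κ) (M : ℕ) (es : List (ℕ × ℕ)) (t : ℕ → ℕ)
    (ht : ∀ k, M ≤ k → t k = 0) (h : signedCount es t ≠ 0) (L : Fin M → Finset α)
    (hL : ∀ i : Fin M, t i < (L i).card) :
    ∃ c : Fin M → α, (∀ i, c i ∈ L i) ∧
      ∀ i j : Fin M, ((i : ℕ), (j : ℕ)) ∈ es → c i ≠ c j := by
  classical
  have hc := coeff_pairPoly M es t ht
  rw [← hc] at h
  have hdeg := (isHomogeneous_pairPoly M es).coeff_eq_zero
    (d := Finsupp.equivFunOnFinite.symm fun k : Fin M => t k)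
  have hne : pairPoly M es ≠ 0 := fun h0 => h (by rw [h0]; simp)
  -- The polynomial is homogeneous, so a monomial with nonzero coefficient has the top degree that
  -- the combinatorial Nullstellensatz requires.
  obtain ⟨s, hs, hs'⟩ := MvPolynomial.combinatorial_nullstellensatz_exists_eval_nonzero
    (pairPoly M es) _ h (by
      rw [(isHomogeneous_pairPoly M es).totalDegree hne]
      by_contra hlen
      exact h (hdeg (Ne.symm hlen))) (fun i => (L i).image κ) (by
      intro i
      rw [Finset.card_image_of_injective _ hκ]
      simpa using hL i)
  choose c hc using fun i => Finset.mem_image.mp (hs i)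
  refine ⟨c, fun i => (hc i).1, fun i j hij heq => ?_⟩
  apply eval_pairPoly_ne_zero M es s hs' _ hij i.2 j.2
  change s i = s j
  rw [← (hc i).2, ← (hc j).2, heq]

/-! ### Continuous logarithms and the nonplanarity of `K₃,₃` -/

open scoped unitInterval

/-- `d` is the total change of a continuous logarithm along the path `f` in the punctured plane. -/
def IsLogChange (f : C(I, ℂ)) (d : ℂ) : Prop :=
  ∃ L : C(I, ℂ), (∀ t, Complex.exp (L t) = f t) ∧ d = L 1 - L 0

/-- Two logarithms of the same path differ by 2πi times a continuous integer-valued function, which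
is constant on the interval. -/
theorem IsLogChange.unique {f : C(I, ℂ)} {d d' : ℂ} (h : IsLogChange f d)
    (h' : IsLogChange f d') : d = d' := by
  obtain ⟨L, hL, rfl⟩ := h
  obtain ⟨L', hL', rfl⟩ := h'
  have hint : ∀ t, ∃ n : ℤ, L t = L' t + n * (2 * Real.pi * Complex.I) := fun t =>
    Complex.exp_eq_exp_iff_exists_int.mp ((hL t).trans (hL' t).symm)
  have key : ∀ t, (L - L') t = (L - L') 0 := by
    choose n hn using hint
    have hne : (2 * Real.pi * Complex.I : ℂ) ≠ 0 := Complex.two_pi_I_ne_zero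
    have hcont : Continuous fun t => ((n t : ℝ)) := by
      have : (fun t => ((n t : ℝ))) = fun t => ((L t - L' t) / (2 * Real.pi * Complex.I)).re := by
        ext t
        rw [hn t, add_sub_cancel_left, mul_div_cancel_right₀ _ hne]
        simp
      rw [this]
      exact Complex.continuous_re.comp (by fun_prop)
    have hn' : Continuous n := Int.isClosedEmbedding_coe_real.isEmbedding.continuous_iff.mpr hcont
    intro t
    have := PreconnectedSpace.constant (inferInstance : PreconnectedSpace I) hn' (x := t) (y := 0)
    simp only [ContinuousMap.coe_sub, Pi.sub_apply]
    rw [hn t, hn 0, this]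
    ring
  have := key 1
  simp only [ContinuousMap.coe_sub, Pi.sub_apply] at this
  linear_combination this

theorem IsLogChange.neg {f : C(I, ℂ)} {d : ℂ} (h : IsLogChange f d) : IsLogChange (-f) d := by
  obtain ⟨L, hL, rfl⟩ := h
  refine ⟨L + ContinuousMap.const I (Real.pi * Complex.I), fun t => ?_, by simp⟩
  simp [Complex.exp_add, hL t]

theorem IsLogChange.exp_eq {f : C(I, ℂ)} {d : ℂ} (h : IsLogChange f d) :
    Complex.exp d = f 1 / f 0 := by
  obtain ⟨L, hL, rfl⟩ := h
  rw [Complex.exp_sub, hL, hL]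

/-- Clamping the coordinates extends `F` to the whole plane, where it lifts through the covering of
the punctured plane by the exponential map. -/
theorem exists_log_of_ne_zero (F : C(I × I, ℂ)) (hF : ∀ x, F x ≠ 0) :
    ∃ L : C(I × I, ℂ), ∀ x, Complex.exp (L x) = F x := by
  have hproj : Continuous (Set.projIcc (0 : ℝ) 1 zero_le_one) := continuous_projIcc
  obtain ⟨L, ⟨-, hL⟩, -⟩ := Complex.isCoveringMapOn_exp.existsUnique_continuousMap_lifts
    (⟨fun x : ℝ × ℝ => F (Set.projIcc 0 1 zero_le_one x.1, Set.projIcc 0 1 zero_le_one x.2),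
      by fun_prop⟩ : C(ℝ × ℝ, ℂ))
    (a₀ := (0, 0)) (Complex.exp_log (hF _)) (fun x => hF _)
  exact ⟨⟨fun x => L (x.1, x.2), by fun_prop⟩, fun x => by simpa using congrFun hL (x.1, x.2)⟩

/-- For disjoint paths `f`, `g`, the changes of the logarithm of `f s - g t` along the sides of the
square add up to zero. -/
theorem exists_isLogChange_square (f g : C(I, ℂ)) (h : ∀ s t, f s ≠ g t) :
    ∃ p q r u : ℂ, IsLogChange (ContinuousMap.const I (f 0) - g) p ∧
      IsLogChange (ContinuousMap.const I (g 1) - f) q ∧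
      IsLogChange (ContinuousMap.const I (g 0) - f) r ∧
      IsLogChange (ContinuousMap.const I (f 1) - g) u ∧ p + q = r + u := by
  obtain ⟨L, hL⟩ := exists_log_of_ne_zero ⟨fun x => f x.1 - g x.2, by fun_prop⟩
    (fun x => sub_ne_zero.mpr (h _ _))
  simp only [ContinuousMap.coe_mk] at hL
  have hneg : ∀ c d, IsLogChange (f - ContinuousMap.const I c) d →
      IsLogChange (ContinuousMap.const I c - f) d := fun c d hd => by
    simpa using hd.neg
  refine ⟨L (0, 1) - L (0, 0), L (1, 1) - L (0, 1), L (1, 0) - L (0, 0), L (1, 1) - L (1, 0),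
    ⟨⟨fun t => L (0, t), by fun_prop⟩, ?_, rfl⟩, hneg _ _ ⟨⟨fun t => L (t, 1), by fun_prop⟩, ?_, rfl⟩,
    hneg _ _ ⟨⟨fun t => L (t, 0), by fun_prop⟩, ?_, rfl⟩, ⟨⟨fun t => L (1, t), by fun_prop⟩, ?_, rfl⟩,
    by ring⟩ <;> intro t <;> simp [hL]

/-- The graph `K₃,₃` cannot be drawn in the plane such that independent edges are disjoint. -/
theorem not_exists_disjoint_paths (a b : Fin 3 → ℂ) (γ : Fin 3 → Fin 3 → C(I, ℂ))
    (h0 : ∀ i j, γ i j 0 = a i) (h1 : ∀ i j, γ i j 1 = b j)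
    (hd : ∀ i j k l, i ≠ k → j ≠ l → ∀ s t, γ i j s ≠ γ k l t) : False := by
  have hex : ∀ i j k l, i ≠ k → j ≠ l → _ := fun i j k l hik hjl =>
    exists_isLogChange_square (γ i j) (γ k l) (hd i j k l hik hjl)
  simp only [h0, h1] at hex
  have hother : ∀ j : Fin 3, ∃ l, j ≠ l := by decide
  -- `P i k l` is the change of log (a i - z) as z runs along `γ k l`, and `Q j k l` is the same for
  -- `b j`. By uniqueness they do not depend on the square used to find them, so relations from
  -- different squares share terms. The value 0 is a dummy.
  have hP : ∀ i k l, ∃ p, i ≠ k → IsLogChange (ContinuousMap.const I (a i) - γ k l) p := by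
    intro i k l
    by_cases hik : i = k
    · exact ⟨0, fun h => absurd hik h⟩
    · obtain ⟨j, hj⟩ := hother l
      obtain ⟨p, -, -, -, hp, -⟩ := hex i j k l hik hj.symm
      exact ⟨p, fun _ => hp⟩
  have hQ : ∀ j k l, ∃ p, j ≠ l → IsLogChange (ContinuousMap.const I (b j) - γ k l) p := by
    intro j k l
    by_cases hjl : j = l
    · exact ⟨0, fun h => absurd hjl h⟩
    · obtain ⟨i, hi⟩ := hother k
      obtain ⟨-, -, -, u, -, -, -, hu, -⟩ := hex i j k l hi.symm hjl
      exact ⟨u, fun _ => hu⟩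
  choose P hP using hP
  choose Q hQ using hQ
  have rel : ∀ i j k l, i ≠ k → j ≠ l → P i k l + Q l i j = P k i j + Q j k l := by
    intro i j k l hik hjl
    obtain ⟨p, q, r, u, hp, hq, hr, hu, he⟩ := hex i j k l hik hjl
    rw [(hP i k l hik).unique hp, (hQ l i j hjl.symm).unique hq, (hP k i j hik.symm).unique hr,
      (hQ j k l hjl).unique hu, he]
  have hPe : ∀ i k l, i ≠ k → Complex.exp (P i k l) = (a i - b l) / (a i - a k) := by
    intro i k l hik
    simpa [h0, h1] using (hP i k l hik).exp_eq
  have hQe : ∀ j k l, j ≠ l → Complex.exp (Q j k l) = (b j - b l) / (b j - a k) := by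
    intro j k l hjl
    simpa [h0, h1] using (hQ j k l hjl).exp_eq
  have hab : ∀ i j, a i - b j ≠ 0 := by
    intro i j
    obtain ⟨k, hk⟩ := hother i
    obtain ⟨l, hl⟩ := hother j
    have := hd i l k j hk hl.symm 0 1
    rw [h0, h1] at this
    exact sub_ne_zero.mpr this
  have haa : ∀ i k, i ≠ k → a i - a k ≠ 0 := by
    intro i k hik
    have := hd i 0 k 1 hik (by decide) 0 0
    rw [h0, h0] at this
    exact sub_ne_zero.mpr this
  have hbb : ∀ j l, j ≠ l → b j - b l ≠ 0 := by
    intro j l hjl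
    have := hd 0 j 1 l (by decide) hjl 1 1
    rw [h1, h1] at this
    exact sub_ne_zero.mpr this
  have hPP : ∀ i k l, i ≠ k → Complex.exp (P i k l - P k i l) = -((a i - b l) / (a k - b l)) := by
    intro i k l hik
    rw [Complex.exp_sub, hPe _ _ _ hik, hPe _ _ _ hik.symm]
    have h1 := haa i k hik
    have h2 := haa k i hik.symm
    have h3 := hab k l
    field_simp
    ring
  have hQQ : ∀ j l, j ≠ l → Complex.exp (Q l 0 j - Q l 2 j) = (a 2 - b l) / (a 0 - b l) := by
    intro j l hjl
    rw [Complex.exp_sub, hQe _ _ _ hjl.symm, hQe _ _ _ hjl.symm]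
    have h1 := hbb l j hjl.symm
    have h2 := hab 0 l
    have h3 := hab 2 l
    have h4 : b l - a 0 ≠ 0 := by rw [← neg_sub]; exact neg_ne_zero.mpr h2
    have h5 : b l - a 2 ≠ 0 := by rw [← neg_sub]; exact neg_ne_zero.mpr h3
    field_simp
    ring
  -- There are 18 relations, one for each pair of independent edges. In their sum the terms `Q l 1
  -- j` cancel and every other term occurs twice. The sum is halved before exponentiation, which is
  -- why a sign survives.
  have hsum : ((P 0 1 0 - P 1 0 0) + (P 0 2 0 - P 2 0 0) + (P 1 2 0 - P 2 1 0) +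
      (Q 0 0 1 - Q 0 2 1) + (Q 0 0 2 - Q 0 2 2)) +
      ((P 0 1 1 - P 1 0 1) + (P 0 2 1 - P 2 0 1) + (P 1 2 1 - P 2 1 1) +
      (Q 1 0 0 - Q 1 2 0) + (Q 1 0 2 - Q 1 2 2)) +
      ((P 0 1 2 - P 1 0 2) + (P 0 2 2 - P 2 0 2) + (P 1 2 2 - P 2 1 2) +
      (Q 2 0 0 - Q 2 2 0) + (Q 2 0 1 - Q 2 2 1)) = 0 := by
    linear_combination (1 / 2 : ℂ) * (rel 0 0 1 1 (by decide) (by decide) + rel 0 0 1 2 (by decide) (by decide) +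
      rel 0 1 1 0 (by decide) (by decide) + rel 0 1 1 2 (by decide) (by decide) +
      rel 0 2 1 0 (by decide) (by decide) + rel 0 2 1 1 (by decide) (by decide) +
      rel 0 0 2 1 (by decide) (by decide) + rel 0 0 2 2 (by decide) (by decide) +
      rel 0 1 2 0 (by decide) (by decide) + rel 0 1 2 2 (by decide) (by decide) +
      rel 0 2 2 0 (by decide) (by decide) + rel 0 2 2 1 (by decide) (by decide) +
      rel 1 0 2 1 (by decide) (by decide) + rel 1 0 2 2 (by decide) (by decide) +
      rel 1 1 2 0 (by decide) (by decide) + rel 1 1 2 2 (by decide) (by decide) +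
      rel 1 2 2 0 (by decide) (by decide) + rel 1 2 2 1 (by decide) (by decide))
  -- The three differences of `P` contribute a factor -1 each, and all quotients cancel. The product
  -- over the three columns is -1, whereas `hsum` makes it exp 0 = 1.
  have hcol : ∀ l j j', j ≠ l → j' ≠ l →
      Complex.exp ((P 0 1 l - P 1 0 l) + (P 0 2 l - P 2 0 l) + (P 1 2 l - P 2 1 l) +
      (Q l 0 j - Q l 2 j) + (Q l 0 j' - Q l 2 j')) = -1 := by
    intro l j j' hj hj'
    rw [Complex.exp_add, Complex.exp_add, Complex.exp_add, Complex.exp_add,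
      hPP 0 1 l (by decide), hPP 0 2 l (by decide), hPP 1 2 l (by decide), hQQ _ _ hj, hQQ _ _ hj']
    have h1 := hab 0 l
    have h2 := hab 1 l
    have h3 := hab 2 l
    field_simp
  have := congrArg Complex.exp hsum
  rw [Complex.exp_add, Complex.exp_add, hcol 0 1 2 (by decide) (by decide),
    hcol 1 0 2 (by decide) (by decide), hcol 2 0 1 (by decide) (by decide)] at this
  norm_num at this

/-! ### Planar graphs do not contain the Petersen graph -/

open scoped unitInterval

namespace SimpleGraph

variable {V : Type*} {G : SimpleGraph V}

namespace PlanarEmbedding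

variable (E : G.PlanarEmbedding)

/-- The part of the plane covered by the drawing of a walk. -/
def walkSet {u v : V} (w : G.Walk u v) : Set (EuclideanSpace ℝ (Fin 2)) :=
  {z | (∃ x ∈ w.support, z = E.point x) ∨
    ∃ e : G.edgeSet, (e : Sym2 V) ∈ w.edges ∧ ∃ t ∈ Set.Ioo (0 : I) 1, z = E.arc e t}

theorem disjoint_walkSet {u v u' v' : V} (w : G.Walk u v) (w' : G.Walk u' v')
    (h : ∀ x ∈ w.support, x ∉ w'.support) : Disjoint (E.walkSet w) (E.walkSet w') := by
  rw [Set.disjoint_left]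
  rintro z (⟨x, hx, rfl⟩ | ⟨e, he, t, ht, rfl⟩) (⟨y, hy, hz⟩ | ⟨e', he', t', ht', hz⟩)
  · rw [E.point_injective hz] at hx
    exact h _ hx hy
  · exact E.arc_ne_point e' t' ht' x hz.symm
  · exact E.arc_ne_point e t ht y hz
  · by_cases hee : e = e'
    · subst hee
      obtain ⟨⟨a, b⟩, hab⟩ := e
      exact h a (w.fst_mem_support_of_mem_edges he) (w'.fst_mem_support_of_mem_edges he')
    · exact E.arc_disjoint e e' hee t ht t' ht' hz

/-- The arc of an edge has no prescribed direction, so it may have to be reversed. -/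
theorem exists_path_of_adj {u v : V} (h : G.Adj u v) :
    ∃ γ : _root_.Path (E.point u) (E.point v), ∀ t, γ t = E.point u ∨ γ t = E.point v ∨
      ∃ s ∈ Set.Ioo (0 : I) 1, γ t = E.arc ⟨s(u, v), h⟩ s := by
  have hI : ∀ t : I, t = 0 ∨ t = 1 ∨ t ∈ Set.Ioo (0 : I) 1 := fun t => by
    rcases eq_or_lt_of_le (unitInterval.nonneg' (t := t)) with h | h
    · exact Or.inl h.symm
    · rcases eq_or_lt_of_le (unitInterval.le_one' (t := t)) with h' | h'
      · exact Or.inr (Or.inl h')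
      · exact Or.inr (Or.inr ⟨h, h'⟩)
  have hends := E.arc_ends ⟨s(u, v), h⟩
  simp only [Sym2.map_mk, Sym2.eq_iff] at hends
  rcases hends with ⟨h0, h1⟩ | ⟨h0, h1⟩
  · refine ⟨⟨E.arc ⟨s(u, v), h⟩, h0, h1⟩, fun t => ?_⟩
    rcases hI t with rfl | rfl | ht
    · exact Or.inl h0
    · exact Or.inr (Or.inl h1)
    · exact Or.inr (Or.inr ⟨t, ht, rfl⟩)
  · let γ : _root_.Path (E.point v) (E.point u) := ⟨E.arc ⟨s(u, v), h⟩, h0, h1⟩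
    refine ⟨γ.symm, fun t => ?_⟩
    rw [_root_.Path.symm_apply, Function.comp_apply]
    rcases hI (σ t) with h | h | ht
    · rw [h, γ.source]
      exact Or.inr (Or.inl rfl)
    · rw [h, γ.target]
      exact Or.inl rfl
    · exact Or.inr (Or.inr ⟨_, ht, rfl⟩)

theorem exists_path_in_walkSet {u v : V} (w : G.Walk u v) :
    ∃ γ : _root_.Path (E.point u) (E.point v), ∀ t, γ t ∈ E.walkSet w := by
  induction w with
  | nil => exact ⟨_root_.Path.refl _, fun t => Or.inl ⟨_, Walk.start_mem_support _, rfl⟩⟩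
  | @cons a b c h p ih =>
    obtain ⟨γ, hγ⟩ := ih
    obtain ⟨δ, hδ⟩ := E.exists_path_of_adj h
    refine ⟨δ.trans γ, fun t => ?_⟩
    have hmem : δ.trans γ t ∈ Set.range (δ.trans γ) := ⟨t, rfl⟩
    rw [_root_.Path.trans_range] at hmem
    rcases hmem with ⟨s, hs⟩ | ⟨s, hs⟩ <;> rw [← hs]
    · rcases hδ s with h' | h' | ⟨r, hr, h'⟩
      · exact Or.inl ⟨a, by simp, h'⟩
      · exact Or.inl ⟨b, by simp, h'⟩
      · exact Or.inr ⟨_, by simp, r, hr, h'⟩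
    · rcases hγ s with ⟨x, hx, h'⟩ | ⟨e, he, r, hr, h'⟩
      · exact Or.inl ⟨x, by simp [hx], h'⟩
      · exact Or.inr ⟨e, by simp [he], r, hr, h'⟩

end PlanarEmbedding

/-- A planar graph does not contain a subdivision of `K₃,₃`. -/
theorem IsPlanar.not_disjoint_walks (hG : G.IsPlanar) (a b : Fin 3 → V)
    (w : ∀ i j, G.Walk (a i) (b j))
    (hd : ∀ i j k l, i ≠ k → j ≠ l → ∀ x ∈ (w i j).support, x ∉ (w k l).support) : False := by
  obtain ⟨E⟩ := hG
  choose γ hγ using fun i j => E.exists_path_in_walkSet (w i j)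
  let φ := Complex.orthonormalBasisOneI.repr.symm
  refine not_exists_disjoint_paths (fun i => φ (E.point (a i))) (fun j => φ (E.point (b j)))
    (fun i j => ⟨fun t => φ (γ i j t), by fun_prop⟩) (by simp) (by simp) ?_
  intro i j k l hik hjl s t h
  have h' : γ i j s = γ k l t := φ.injective h
  refine Set.disjoint_left.mp (E.disjoint_walkSet _ _ (hd i j k l hik hjl)) (hγ i j s) ?_
  rw [h']
  exact hγ k l t

/-- The edges of the Petersen graph, with outer cycle `0, 1, 2, 3, 4` and inner vertices
`5, 6, 7, 8, 9`. -/
def petersenEdges : List (Fin 10 × Fin 10) :=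
  [(0, 1), (1, 2), (2, 3), (3, 4), (4, 0), (0, 5), (1, 6), (2, 7), (3, 8), (4, 9),
    (5, 7), (6, 8), (7, 9), (8, 5), (9, 6)]

/-- The Petersen graph. -/
def petersen : SimpleGraph (Fin 10) where
  Adj i j := (i, j) ∈ petersenEdges ∨ (j, i) ∈ petersenEdges
  symm := ⟨fun _ _ h => h.symm⟩
  loopless := ⟨by decide⟩

instance : DecidableRel petersen.Adj := fun i j =>
  inferInstanceAs (Decidable ((i, j) ∈ petersenEdges ∨ (j, i) ∈ petersenEdges))

/-- The first side of a subdivision of `K₃,₃` in the Petersen graph. -/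
def petersenSource : Fin 3 → Fin 10 := ![2, 8, 9]

/-- The second side of a subdivision of `K₃,₃` in the Petersen graph. -/
def petersenTarget : Fin 3 → Fin 10 := ![3, 6, 7]

/-- The inner vertices of the nine paths of a subdivision of `K₃,₃` in the Petersen graph. -/
def petersenInner : Fin 3 → Fin 3 → List (Fin 10) :=
  ![![[], [1], []], ![[], [], [5]], ![[4], [], []]]

/-- Deleting vertex 0 leaves its neighbors 1, 4, 5 with degree two; suppressing them turns the rest
of the Petersen graph into `K₃,₃`. -/
theorem exists_petersen_walk (i j : Fin 3) :
    ∃ w : petersen.Walk (petersenSource i) (petersenTarget j),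
      w.support = petersenSource i :: (petersenInner i j ++ [petersenTarget j]) := by
  have h : ∀ i j, petersenInner i j = [] ∧ petersen.Adj (petersenSource i) (petersenTarget j) ∨
      ∃ x, petersenInner i j = [x] ∧ petersen.Adj (petersenSource i) x ∧
        petersen.Adj x (petersenTarget j) := by decide
  rcases h i j with ⟨h, h'⟩ | ⟨x, h, h', h''⟩
  · exact ⟨h'.toWalk, by simp [h]⟩
  · exact ⟨.cons h' h''.toWalk, by simp [h]⟩

theorem IsPlanar.not_petersen (hG : G.IsPlanar) (f : Fin 10 → V) (hf : Function.Injective f)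
    (hadj : ∀ e ∈ petersenEdges, G.Adj (f e.1) (f e.2)) : False := by
  choose w hw using exists_petersen_walk
  let φ : petersen →g G := ⟨f, fun {i j} h => h.elim (hadj (i, j)) fun h => (hadj (j, i) h).symm⟩
  refine hG.not_disjoint_walks (fun i => φ (petersenSource i)) (fun j => φ (petersenTarget j))
    (fun i j => (w i j).map φ) ?_
  have hd : ∀ i j k l : Fin 3, i ≠ k → j ≠ l →
      ∀ x ∈ petersenSource i :: (petersenInner i j ++ [petersenTarget j]),
      x ∉ petersenSource k :: (petersenInner k l ++ [petersenTarget l]) := by decide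
  intro i j k l hik hjl x hx hx'
  rw [Walk.support_map, List.mem_map, hw] at hx hx'
  obtain ⟨y, hy, rfl⟩ := hx
  obtain ⟨z, hz, hzy⟩ := hx'
  rw [hf hzy] at hz
  exact hd i j k l hik hjl y hy hz

end SimpleGraph

/-! ### A nonzero coefficient for squares of long cycles -/

theorem signedCount_eq_zero {es : List (ℕ × ℕ)} {t : ℕ → ℕ} {k : ℕ} (ht : t k ≠ 0)
    (hk : ∀ e ∈ es, e.1 ≠ k ∧ e.2 ≠ k) : signedCount es t = 0 := by
  induction es generalizing t with
  | nil =>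
    rw [signedCount, if_neg]
    exact fun h => ht (h k)
  | cons e es ih =>
    have he := hk e (by simp)
    have hes : ∀ e ∈ es, e.1 ≠ k ∧ e.2 ≠ k := fun e he => hk e (by simp [he])
    rw [signedCount, ih (by rwa [Function.update_of_ne he.1.symm]) hes,
      ih (by rwa [Function.update_of_ne he.2.symm]) hes]
    simp

section Elimination

variable {es : List (ℕ × ℕ)} {t : ℕ → ℕ} {k p q : ℕ}

/-- Only the first two factors contain the variable of `k`, so both must contribute it. For
exponents 1 and 0, treated next, exactly one and none of them does. This removes the last vertex of
the square of a path. -/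
theorem signedCount_eliminate_two (hk : ∀ e ∈ es, e.1 ≠ k ∧ e.2 ≠ k) (hp : p ≠ k) (hq : q ≠ k)
    (ht : t k = 2) :
    signedCount ((k, p) :: (k, q) :: es) t = signedCount es (Function.update t k 0) := by
  simp only [signedCount, ht, Function.update_self, Function.update_of_ne hp.symm,
    Function.update_idem]
  rw [signedCount_eq_zero (k := k) (t := Function.update (Function.update t k (2 - 1)) q _) _ hk,
    signedCount_eq_zero (k := k) (t := Function.update (Function.update t p _) k _) _ hk,
    signedCount_eq_zero (k := k) (t := Function.update (Function.update t p _) q _) _ hk]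
  · simp
  · simp [Function.update_of_ne hp.symm, Function.update_of_ne hq.symm, ht]
  · simp
  · simp [Function.update_of_ne hq.symm]

theorem signedCount_eliminate_one (hk : ∀ e ∈ es, e.1 ≠ k ∧ e.2 ≠ k) (hp : p ≠ k) (hq : q ≠ k)
    (hpq : p ≠ q) (ht : t k = 1) :
    signedCount ((k, p) :: (k, q) :: es) t =
      -(if t p = 0 then 0 else
        signedCount es (Function.update (Function.update t k 0) p (t p - 1))) -
      (if t q = 0 then 0 else
        signedCount es (Function.update (Function.update t k 0) q (t q - 1))) := by
  simp only [signedCount, ht, Function.update_self, Function.update_of_ne hp.symm,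
    Function.update_of_ne hq, Function.update_of_ne hpq.symm]
  rw [signedCount_eq_zero (k := k) (t := Function.update (Function.update t p _) q _) _ hk,
    Function.update_comm hp]
  · simp
    ring
  · simp [Function.update_of_ne hp.symm, Function.update_of_ne hq.symm, ht]

theorem signedCount_eliminate_zero (hp : p ≠ k) (hpq : p ≠ q) (ht : t k = 0) :
    signedCount ((k, p) :: (k, q) :: es) t =
      if t p = 0 then 0 else if t q = 0 then 0 else
        signedCount es (Function.update (Function.update t p (t p - 1)) q (t q - 1)) := by
  simp only [signedCount, ht, Function.update_of_ne hp.symm, Function.update_of_ne hpq.symm]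
  split_ifs <;> simp

end Elimination

/-- The edges of the square of a path with vertices `2, …, m + 5`, together with two further
vertices `0`, `1` that are joined to `2, 3, 4` and to `3, 4, 5`. -/
def bandEdges : ℕ → List (ℕ × ℕ)
  | 0 => [(0, 2), (0, 3), (0, 4), (1, 3), (1, 4), (1, 5), (3, 2), (4, 3), (4, 2), (5, 4), (5, 3)]
  | m + 1 => (m + 6, m + 5) :: (m + 6, m + 4) :: bandEdges m

/-- Exponents on the vertices `0, …, m + 5` with prescribed values at the two last vertices. -/
def bandExp (l : ℕ → ℕ) (m a b : ℕ) (k : ℕ) : ℕ :=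
  if k < m + 4 then l k else if k = m + 4 then b else if k = m + 5 then a else 0

theorem bandEdges_lt (m : ℕ) : ∀ e ∈ bandEdges m, e.1 < m + 6 ∧ e.2 < m + 6 := by
  induction m with
  | zero => decide
  | succ m ih =>
    intro e he
    simp only [bandEdges, List.mem_cons] at he
    rcases he with rfl | rfl | he
    · simp
    · simp
    · have := ih e he
      omega

section Band

variable {l : ℕ → ℕ} {m : ℕ}

theorem bandExp_update_last (a b c : ℕ) :
    Function.update (bandExp l m a b) (m + 5) c = bandExp l m c b := by
  ext k
  simp only [Function.update_apply, bandExp]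
  split_ifs <;> first | rfl | omega

theorem bandExp_update_penultimate (a b c : ℕ) :
    Function.update (bandExp l m a b) (m + 4) c = bandExp l m a c := by
  ext k
  simp only [Function.update_apply, bandExp]
  split_ifs <;> first | rfl | omega

theorem bandExp_update_of_lt (a b c : ℕ) {i : ℕ} (hi : i < m + 4) :
    Function.update (bandExp l m a b) i c = bandExp (Function.update l i c) m a b := by
  ext k
  simp only [Function.update_apply, bandExp]
  split_ifs <;> first | rfl | omega

theorem bandExp_last (a b : ℕ) : bandExp l m a b (m + 5) = a := by simp [bandExp]

theorem bandExp_penultimate (a b : ℕ) : bandExp l m a b (m + 4) = b := by simp [bandExp]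

theorem bandExp_of_lt (a b : ℕ) {i : ℕ} (hi : i < m + 4) : bandExp l m a b i = l i := by
  simp [bandExp, hi]

/-- Once the last vertex is removed, the penultimate one becomes the last, and `m + 4` becomes
penultimate with its own exponent 2. -/
theorem bandExp_succ_update (hl : l (m + 4) = 2) (a b : ℕ) :
    Function.update (bandExp l (m + 1) a b) (m + 6) 0 = bandExp l m b 2 := by
  ext k
  simp only [Function.update_apply, bandExp]
  split_ifs <;> first | rfl | omega | (subst_vars; exact hl)

theorem bandEdges_ne (m : ℕ) : ∀ e ∈ bandEdges m, e.1 ≠ m + 6 ∧ e.2 ≠ m + 6 := fun e he => by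
  have := bandEdges_lt m e he
  omega

/-- The coefficient that belongs to `bandExp`. -/
noncomputable def bandCount (l : ℕ → ℕ) (m a b : ℕ) : ℤ :=
  signedCount (bandEdges m) (bandExp l m a b)

theorem bandCount_two (hl : l (m + 4) = 2) (b : ℕ) :
    bandCount l (m + 1) 2 b = bandCount l m b 2 := by
  rw [bandCount, bandEdges, signedCount_eliminate_two (bandEdges_ne m) (by omega) (by omega)
    (bandExp_last (m := m + 1) _ _), bandExp_succ_update hl, bandCount]

theorem bandCount_one (hl : l (m + 4) = 2) (b : ℕ) :
    bandCount l (m + 1) 1 b =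
      -(if b = 0 then 0 else bandCount l m (b - 1) 2) - bandCount l m b 1 := by
  rw [bandCount, bandEdges, signedCount_eliminate_one (bandEdges_ne m) (by omega) (by omega)
    (by omega) (bandExp_last (m := m + 1) _ _), bandExp_succ_update hl, bandExp_update_last,
    bandExp_update_penultimate, bandExp_penultimate (m := m + 1),
    bandExp_of_lt (m := m + 1) (i := m + 4) _ _ (by omega), hl]
  simp [bandCount]

theorem bandCount_zero (hl : l (m + 4) = 2) (b : ℕ) :
    bandCount l (m + 1) 0 b = if b = 0 then 0 else bandCount l m (b - 1) 1 := by
  rw [bandCount, bandEdges, signedCount_eliminate_zero (by omega) (by omega)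
    (bandExp_last (m := m + 1) _ _), bandExp_penultimate (m := m + 1),
    bandExp_of_lt (m := m + 1) (i := m + 4) _ _ (by omega), hl]
  have h : bandExp l (m + 1) 0 b = Function.update (bandExp l (m + 1) 0 b) (m + 6) 0 := by
    rw [bandExp_update_last (m := m + 1)]
  rw [h, bandExp_succ_update hl, bandExp_update_last, bandExp_update_penultimate]
  simp [bandCount]

/-- Elimination acts linearly on the states (a, b). It fixes (2, 2) and (0, 1), and on each of the
pairs (1, 2), (2, 1) and (1, 1), (0, 2) it acts with characteristic polynomial λ² + λ + 1. Hence its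
cube is the identity. -/
theorem bandCount_add_three (hl : ∀ k, m + 4 ≤ k → l k = 2) (a b : ℕ) (ha : a ≤ 2) (hb : b ≤ 2)
    (hb' : 1 ≤ b) : bandCount l (m + 3) a b = bandCount l m a b := by
  have h0 := hl (m + 4) le_rfl
  have h1 := hl (m + 1 + 4) (by omega)
  have h2 := hl (m + 2 + 4) (by omega)
  interval_cases a <;> interval_cases b <;>
  simp [bandCount_zero h2, bandCount_one h2, bandCount_two h2, bandCount_zero h1, bandCount_one h1,
    bandCount_two h1, bandCount_zero h0, bandCount_one h0, bandCount_two h0] <;> ring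

end Band

/-- The edges of the square of a cycle with vertices `2, …, m + 5`, together with two further
vertices `0`, `1` that are joined to `2, 3, 4` and to `3, 4, 5`. -/
def cycleEdges (m : ℕ) : List (ℕ × ℕ) :=
  (m + 5, 2) :: (m + 5, 3) :: (m + 4, 2) :: bandEdges m

/-- Expanding the three closing edges reduces the statement to the path. Only one of them meets `m +
4`, so the penultimate exponent stays at least 1, as `bandCount_add_three` requires; the other
changes are at 2, 3 and the last vertex. -/
theorem signedCount_cycleEdges_add_three {l : ℕ → ℕ} {m : ℕ} (hl : ∀ k, m + 4 ≤ k → l k = 2) :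
    signedCount (cycleEdges (m + 3)) (bandExp l (m + 3) 2 2) =
      signedCount (cycleEdges m) (bandExp l m 2 2) := by
  have key : ∀ l' : ℕ → ℕ, (∀ k, 4 ≤ k → l' k = l k) → ∀ a b, a ≤ 2 → b ≤ 2 → 1 ≤ b →
      signedCount (bandEdges (m + 3)) (bandExp l' (m + 3) a b) =
      signedCount (bandEdges m) (bandExp l' m a b) := by
    intro l' hl' a b ha hb hb'
    refine bandCount_add_three (fun k hk => ?_) a b ha hb hb'
    rw [hl' k (by omega), hl k hk]
  have hu : ∀ l' : ℕ → ℕ, (∀ k, 4 ≤ k → l' k = l k) → ∀ i, i < 4 → ∀ x, ∀ k, 4 ≤ k →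
      Function.update l' i x k = l k := by
    intro l' hl' i hi x k hk
    rw [Function.update_of_ne (by omega), hl' k hk]
  have h2 : ∀ m, 2 < m + 4 := fun m => by omega
  have h3 : ∀ m, 3 < m + 4 := fun m => by omega
  have k0 := key l fun _ _ => rfl
  have k1 := fun i hi x => key _ (hu l (fun _ _ => rfl) i hi x)
  have k2 := fun i hi x j hj y => key _ (hu _ (hu l (fun _ _ => rfl) i hi x) j hj y)
  have k3 := fun i hi x j hj y r hr z =>
    key _ (hu _ (hu _ (hu l (fun _ _ => rfl) i hi x) j hj y) r hr z)
  simp only [cycleEdges, signedCount, bandExp_last, bandExp_penultimate, bandExp_of_lt _ _ (h2 _),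
    bandExp_of_lt _ _ (h3 _), bandExp_update_last, bandExp_update_penultimate,
    bandExp_update_of_lt _ _ _ (h2 _), bandExp_update_of_lt _ _ _ (h3 _)]
  simp [k0, k1, k2, k3]

/-- The default 2 continues the exponents along a cycle of any length; `listCount` needs the default
0 beyond the last vertex. -/
theorem bandExp_eq_getD (L : List ℕ) (m : ℕ) (hL : L.length = m + 6)
    (h4 : L.getD (m + 4) 2 = 2) (h5 : L.getD (m + 5) 2 = 2) :
    bandExp (fun k => L.getD k 2) m 2 2 = fun k => L.getD k 0 := by
  ext k
  simp only [bandExp]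
  by_cases hk : k < L.length
  · have h0 : L.getD k 2 = L.getD k 0 := by
      rw [List.getD_eq_getElem _ _ hk, List.getD_eq_getElem _ _ hk]
    split_ifs with h h' h'
    · exact h0
    · rw [← h0, h', h4]
    · rw [← h0, h', h5]
    · omega
  · rw [List.getD_eq_default _ _ (not_lt.mp hk), List.getD_eq_default _ _ (not_lt.mp hk),
      if_neg (by omega), if_neg (by omega), if_neg (by omega)]

theorem signedCount_cycleEdges_ne_zero_of_list (L : List ℕ) (m : ℕ) (hL : L.length = m + 6)
    (h4 : L.getD (m + 4) 2 = 2) (h5 : L.getD (m + 5) 2 = 2) (h : listCount (cycleEdges m) L ≠ 0) :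
    signedCount (cycleEdges m) (bandExp (fun k => L.getD k 2) m 2 2) ≠ 0 := by
  rwa [bandExp_eq_getD L m hL h4 h5, ← listCount_eq_signedCount]

/-- The graph polynomial of the square of a cycle of length at least seven with two pendant
vertices at adjacent vertices has a nonzero coefficient at small exponents. -/
theorem exists_signedCount_cycleEdges_ne_zero (m : ℕ) (hm : 2 ≤ m) :
    ∃ L ∈ [[1, 1, 3, 3, 3, 3, 2, 2], [1, 1, 3, 3, 4, 3, 2, 1]],
      signedCount (cycleEdges m) (bandExp (fun k => L.getD k 2) m 2 2) ≠ 0 := by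
  have hlist : ∀ (L L' : List ℕ) (m : ℕ), (∀ k, L.getD k 2 = L'.getD k 2) →
      signedCount (cycleEdges m) (bandExp (fun k => L'.getD k 2) m 2 2) ≠ 0 →
      signedCount (cycleEdges m) (bandExp (fun k => L.getD k 2) m 2 2) ≠ 0 := by
    intro L L' m h h'
    rwa [funext h]
  have hpad : ∀ (L : List ℕ) (r : ℕ), ∀ k, L.getD k 2 = (L ++ List.replicate r 2).getD k 2 := by
    intro L r k
    rcases lt_or_ge k L.length with hk | hk
    · rw [List.getD_append _ _ _ _ hk]
    · rw [List.getD_append_right _ _ _ _ hk, List.getD_eq_default _ _ hk]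
      simp only [List.getD_eq_getElem?_getD, List.getElem?_replicate]
      split_ifs <;> rfl
  have hstep : ∀ (L : List ℕ) (r q : ℕ), (∀ k, r + 4 ≤ k → L.getD k 2 = 2) →
      signedCount (cycleEdges r) (bandExp (fun k => L.getD k 2) r 2 2) ≠ 0 →
      signedCount (cycleEdges (r + 3 * q)) (bandExp (fun k => L.getD k 2) (r + 3 * q) 2 2) ≠ 0 := by
    intro L r q hr h
    induction q with
    | zero => exact h
    | succ q ih =>
      rw [show r + 3 * (q + 1) = r + 3 * q + 3 by ring,
        signedCount_cycleEdges_add_three fun k hk => hr k (by omega)]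
      exact ih
  have htail : ∀ k, 2 + 4 ≤ k → [1, 1, 3, 3, 3, 3, 2, 2].getD k 2 = 2 := by
    intro k hk
    rcases lt_or_ge k 8 with h | h
    · interval_cases k <;> rfl
    · exact List.getD_eq_default _ _ h
  -- The period is three, so the base cases are `m` = 2, 3, 4, that is, cycles of length 6, 7, 8.
  obtain ⟨q, h | h | h⟩ : ∃ q, m = 2 + 3 * q ∨ m = 3 + 3 * q ∨ m = 4 + 3 * q :=
    ⟨(m - 2) / 3, by omega⟩ <;> subst h
  · exact ⟨_, List.mem_cons_self, hstep _ _ _ htail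
      (signedCount_cycleEdges_ne_zero_of_list _ 2 rfl rfl rfl (by decide +kernel))⟩
  · exact ⟨_, List.mem_cons_self, hstep _ _ _ (fun k hk => htail k (by omega))
      (hlist _ _ _ (hpad _ 1)
        (signedCount_cycleEdges_ne_zero_of_list _ 3 rfl rfl rfl (by decide +kernel)))⟩
  · exact ⟨_, List.mem_cons_of_mem _ List.mem_cons_self,
      hstep _ _ _ (fun k hk => List.getD_eq_default _ _ hk) (hlist _ _ _ (hpad _ 2)
        (signedCount_cycleEdges_ne_zero_of_list _ 4 rfl rfl rfl (by decide +kernel)))⟩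

/-! ### Squares of graphs of maximum degree three and reducible sets -/

namespace SimpleGraph

variable {V : Type*} (G : SimpleGraph V)

/-- The square of a graph. -/
def square : SimpleGraph V where
  Adj v w := G.Adj v w ∨ G.SecondOrderAdj v w
  symm := ⟨by
    rintro v w (h | ⟨hne, u, hvu, huw⟩)
    · exact Or.inl h.symm
    · exact Or.inr ⟨hne.symm, u, huw.symm, hvu.symm⟩⟩
  loopless := ⟨by
    rintro v (h | ⟨hne, -⟩)
    · exact G.irrefl h
    · exact hne rfl⟩

variable {G}

theorem Adj.square {v w : V} (h : G.Adj v w) : G.square.Adj v w := Or.inl h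

theorem square_adj_of_adj_adj {v u w : V} (hvu : G.Adj v u) (huw : G.Adj u w) (h : v ≠ w) :
    G.square.Adj v w := Or.inr ⟨h, u, hvu, huw⟩

theorem square_adj_iff {v w : V} :
    G.square.Adj v w ↔ G.Adj v w ∨ v ≠ w ∧ ∃ u, G.Adj v u ∧ G.Adj u w := Iff.rfl

variable [Fintype V]

open Classical in
/-- The neighbors of a vertex, as a finset. -/
noncomputable def nbr (G : SimpleGraph V) (v : V) : Finset V := {w | G.Adj v w}

@[simp] theorem mem_nbr {v w : V} : w ∈ G.nbr v ↔ G.Adj v w := by simp [nbr]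

-- A neighbor u of v accounts for u itself and the neighbors of u other than v.
open Classical in
theorem card_square_nbr_le_sum (v : V) :
    (G.square.nbr v).card ≤ ∑ u ∈ G.nbr v, (G.nbr u).card := by
  have hsub : G.square.nbr v ⊆ (G.nbr v).biUnion fun u => insert u ((G.nbr u).erase v) := by
    intro w hw
    rw [mem_nbr, square_adj_iff] at hw
    rw [Finset.mem_biUnion]
    rcases hw with hw | ⟨hne, u, hvu, huw⟩
    · exact ⟨w, by simpa, by simp⟩
    · exact ⟨u, by simpa, by simp [hne.symm, huw]⟩
  refine (Finset.card_le_card hsub).trans (Finset.card_biUnion_le.trans (Finset.sum_le_sum ?_))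
  intro u hu
  have hv : v ∈ G.nbr u := by simpa using (mem_nbr.mp hu).symm
  refine (Finset.card_insert_le _ _).trans ?_
  rw [Finset.card_erase_add_one hv]

theorem card_square_nbr_le (hdeg : ∀ v, (G.nbr v).card ≤ 3) (v : V) :
    (G.square.nbr v).card ≤ 9 := by
  refine (card_square_nbr_le_sum v).trans ((Finset.sum_le_card_nsmul _ _ 3 fun u _ => hdeg u).trans ?_)
  have := hdeg v
  simp only [smul_eq_mul]
  omega

open Classical in
/-- Greedy coloring of the square outside of an edge, by decreasing distance to the edge. -/
theorem exists_partial_coloring (hG : G.Connected) (hdeg : ∀ v, (G.nbr v).card ≤ 3) {s₀ s₁ : V}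
    (h01 : G.Adj s₀ s₁) (W : Finset V) (h0 : s₀ ∉ W) (h1 : s₁ ∉ W) :
    ∃ c : V → Fin 8, ∀ v ∈ W, ∀ w ∈ W, G.square.Adj v w → c v ≠ c w := by
  induction hn : W.card generalizing W with
  | zero =>
    rw [Finset.card_eq_zero] at hn
    subst hn
    exact ⟨fun _ => 0, by simp⟩
  | succ n ih =>
    obtain ⟨v, hv, hmin⟩ := W.exists_min_image (fun v => G.dist v s₀)
      (Finset.card_pos.mp (by omega))
    obtain ⟨c, hc⟩ := ih (W.erase v) (fun h => h0 (Finset.mem_of_mem_erase h))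
      (fun h => h1 (Finset.mem_of_mem_erase h)) (by rw [Finset.card_erase_of_mem hv]; omega)
    -- The vertex `v` is colored last. The next two vertices on a shortest path to `s₀` are closer
    -- to it and thus not in `W`; if `v` is adjacent to `s₀`, then `s₀` and `s₁` serve. At most 9 -
    -- 2 = 7 colors are therefore forbidden.
    have htwo : ∃ x y, x ≠ y ∧ x ∉ W ∧ y ∉ W ∧ G.square.Adj v x ∧ G.square.Adj v y := by
      have hv0 : v ≠ s₀ := fun h => h0 (h ▸ hv)
      have hv1 : v ≠ s₁ := fun h => h1 (h ▸ hv)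
      obtain ⟨p, hp⟩ := hG.exists_walk_length_eq_dist v s₀
      cases p with
      | nil => exact absurd rfl hv0
      | @cons _ u _ hvu p =>
        cases p with
        | nil =>
          exact ⟨s₀, s₁, h01.ne, h0, h1, hvu.square, square_adj_of_adj_adj hvu h01 hv1⟩
        | @cons _ w _ huw p =>
          simp only [Walk.length_cons] at hp
          have hw := dist_le p
          have hu := dist_le (Walk.cons huw p)
          rw [Walk.length_cons] at hu
          refine ⟨u, w, huw.ne, fun h => ?_, fun h => ?_, hvu.square,
            square_adj_of_adj_adj hvu huw ?_⟩
          · have := hmin u h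
            omega
          · have := hmin w h
            omega
          · rintro rfl
            omega
    obtain ⟨x, y, hxy, hx, hy, hvx, hvy⟩ := htwo
    have hcard : ((G.square.nbr v ∩ W).image c).card < (Finset.univ : Finset (Fin 8)).card := by
      refine Finset.card_image_le.trans_lt ?_
      have h9 := card_square_nbr_le hdeg v
      have hsub : G.square.nbr v ∩ W ⊆ ((G.square.nbr v).erase x).erase y := by
        intro z hz
        rw [Finset.mem_inter] at hz
        simp only [Finset.mem_erase]
        exact ⟨fun h => hy (h ▸ hz.2), fun h => hx (h ▸ hz.2), hz.1⟩
      have hle := Finset.card_le_card hsub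
      rw [Finset.card_erase_of_mem (by simpa [hxy.symm] using hvy),
        Finset.card_erase_of_mem (by simpa using hvx)] at hle
      simp only [Finset.card_univ, Fintype.card_fin]
      omega
    obtain ⟨a, -, ha⟩ := Finset.exists_mem_notMem_of_card_lt_card hcard
    have ha' : ∀ w ∈ W, G.square.Adj v w → c w ≠ a := by
      intro w hw hvw h
      exact ha (Finset.mem_image.mpr ⟨w, by simp [hvw, hw], h⟩)
    refine ⟨Function.update c v a, ?_⟩
    intro z hz w hw hzw
    by_cases hzv : z = v
    · subst hzv
      rw [Function.update_self, Function.update_of_ne hzw.ne.symm]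
      exact (ha' w hw hzw).symm
    · by_cases hwv : w = v
      · subst hwv
        rw [Function.update_self, Function.update_of_ne hzv]
        exact ha' z hz hzw.symm
      · rw [Function.update_of_ne hzv, Function.update_of_ne hwv]
        exact hc z (by simp [hz, hzv]) w (by simp [hw, hwv]) hzw

open Classical in
/-- A set of vertices that contains an edge, and whose square can be colored from lists that are
sufficiently long, is reducible. -/
theorem exists_coloring_of_signedCount (hG : G.Connected) (hdeg : ∀ v, (G.nbr v).card ≤ 3) {M : ℕ}
    (f : Fin M → V) (hf : Function.Injective f) (es : List (ℕ × ℕ)) (t : ℕ → ℕ)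
    (hes : ∀ i j : Fin M, G.square.Adj (f i) (f j) →
      ((i : ℕ), (j : ℕ)) ∈ es ∨ ((j : ℕ), (i : ℕ)) ∈ es)
    (ht : ∀ k, M ≤ k → t k = 0) (hcount : signedCount es t ≠ 0)
    (hlist : ∀ i : Fin M, ∃ s : Finset (Fin M), (∀ j ∈ s, G.square.Adj (f i) (f j)) ∧
      t i + 1 + (G.square.nbr (f i)).card ≤ s.card + 8)
    (i₀ i₁ : Fin M) (h01 : G.Adj (f i₀) (f i₁)) :
    ∃ c : V → Fin 8, G.IsDistanceTwoColoring c := by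
  let S : Finset V := Finset.univ.image f
  have hS : ∀ i, f i ∈ S := fun i => Finset.mem_image_of_mem f (Finset.mem_univ i)
  obtain ⟨c, hc⟩ := exists_partial_coloring hG hdeg h01 Sᶜ (by simpa using hS i₀)
    (by simpa using hS i₁)
  let L : Fin M → Finset (Fin 8) := fun i => ((G.square.nbr (f i) \ S).image c)ᶜ
  have hL : ∀ i : Fin M, t i < (L i).card := by
    intro i
    obtain ⟨s, hs, hcard⟩ := hlist i
    have h1 : ((G.square.nbr (f i) \ S).image c).card ≤ (G.square.nbr (f i)).card - s.card := by
      refine Finset.card_image_le.trans ?_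
      rw [← Finset.card_image_of_injective s hf, ← Finset.card_sdiff_of_subset]
      · refine Finset.card_le_card (Finset.sdiff_subset_sdiff le_rfl ?_)
        exact Finset.image_subset_image (Finset.subset_univ s)
      · intro v hv
        obtain ⟨j, hj, rfl⟩ := Finset.mem_image.mp hv
        exact mem_nbr.mpr (hs j hj)
    have h2 : s.card ≤ (G.square.nbr (f i)).card := by
      rw [← Finset.card_image_of_injective s hf]
      refine Finset.card_le_card fun v hv => ?_
      obtain ⟨j, hj, rfl⟩ := Finset.mem_image.mp hv
      exact mem_nbr.mpr (hs j hj)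
    rw [Finset.card_compl, Fintype.card_fin]
    omega
  obtain ⟨d, hdL, hd⟩ := exists_list_coloring_of_signedCount_ne_zero (fun a : Fin 8 => ((a : ℕ) : ℤ))
    (fun a b h => by simpa [Fin.ext_iff] using h) M es t ht hcount L hL
  have hout : ∀ (i : Fin M) (w : V), w ∉ S → G.square.Adj (f i) w → d i ≠ c w := by
    intro i w hw hiw h
    have := hdL i
    simp only [L, Finset.mem_compl] at this
    exact this (Finset.mem_image.mpr ⟨w, by simp [hw, hiw], h.symm⟩)
  have hin : ∀ i j : Fin M, G.square.Adj (f i) (f j) → d i ≠ d j := by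
    intro i j hij
    rcases hes i j hij with h | h
    · exact hd i j h
    · exact (hd j i h).symm
  refine ⟨fun v => if h : ∃ i, f i = v then d h.choose else c v, ?_⟩
  have hval : ∀ i, (if h : ∃ j, f j = f i then d h.choose else c (f i)) = d i := by
    intro i
    have h : ∃ j, f j = f i := ⟨i, rfl⟩
    rw [dif_pos h, hf h.choose_spec]
  have hval' : ∀ v, v ∉ S → (if h : ∃ j, f j = v then d h.choose else c v) = c v := by
    intro v hv
    rw [dif_neg]
    rintro ⟨j, rfl⟩
    exact hv (hS j)
  intro v w hvw
  change G.square.Adj v w at hvw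
  have hcases : ∀ v, (∃ i, f i = v) ∨ v ∉ S := by
    intro v
    by_cases hv : v ∈ S
    · obtain ⟨i, -, hi⟩ := Finset.mem_image.mp hv
      exact Or.inl ⟨i, hi⟩
    · exact Or.inr hv
  dsimp only
  rcases hcases v with ⟨i, rfl⟩ | hv <;> rcases hcases w with ⟨j, rfl⟩ | hw
  · rw [hval, hval]
    exact hin i j hvw
  · rw [hval, hval' w hw]
    exact hout i w hw hvw
  · rw [hval, hval' v hv]
    exact (hout j v hv hvw.symm).symm
  · rw [hval' v hv, hval' w hw]
    exact hc v (by simpa using hv) w (by simpa using hw) hvw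

/-- The pairs `i < j` below `M` with `B i j`. -/
def edgesOf (M : ℕ) (B : ℕ → ℕ → Bool) : List (ℕ × ℕ) :=
  (List.range M).flatMap fun i => ((List.range i).filter fun j => B i j).map fun j => (i, j)

theorem mem_edgesOf {M : ℕ} {B : ℕ → ℕ → Bool} {i j : ℕ} (hi : i < M) (hj : j < i)
    (h : B i j = true) : (i, j) ∈ edgesOf M B := by
  simp [edgesOf, hi, hj, h]

/-- A version of `exists_coloring_of_signedCount` for a small set of vertices with known
adjacency in the square. -/
theorem exists_coloring_of_listCount (hG : G.Connected) (hdeg : ∀ v, (G.nbr v).card ≤ 3) {M : ℕ}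
    (f : Fin M → V) (hf : Function.Injective f) (B : ℕ → ℕ → Bool)
    (hB : ∀ i j : Fin M, j < i → (G.square.Adj (f i) (f j) ↔ B i j = true))
    (d : Fin M → ℕ) (hd : ∀ i, (G.square.nbr (f i)).card ≤ d i) (t : List ℕ)
    (hcheck : t.length = M ∧ listCount (edgesOf M B) t ≠ 0 ∧ ∀ i : Fin M, t.getD i 0 + 1 + d i ≤
      (Finset.univ.filter fun j : Fin M => j < i ∧ B i j = true ∨ i < j ∧ B j i = true).card + 8)
    (i₀ i₁ : Fin M) (h01 : G.Adj (f i₀) (f i₁)) :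
    ∃ c : V → Fin 8, G.IsDistanceTwoColoring c := by
  obtain ⟨hlen, hcount, hsum⟩ := hcheck
  refine exists_coloring_of_signedCount hG hdeg f hf (edgesOf M B) (fun k => t.getD k 0) ?_ ?_ ?_ ?_
    i₀ i₁ h01
  · intro i j hij
    rcases lt_trichotomy i j with h | h | h
    · exact Or.inr (mem_edgesOf j.2 h ((hB j i h).mp hij.symm))
    · subst h
      exact absurd hij (G.square.irrefl)
    · exact Or.inl (mem_edgesOf i.2 h ((hB i j h).mp hij))
  · intro k hk
    exact List.getD_eq_default _ _ (hlen ▸ hk)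
  · rwa [← listCount_eq_signedCount]
  · intro i
    refine ⟨_, ?_, (Nat.add_le_add_left (hd i) _).trans (hsum i)⟩
    intro j hj
    rcases (Finset.mem_filter.mp hj).2 with ⟨h, h'⟩ | ⟨h, h'⟩
    · exact (hB i j h).mpr h'
    · exact ((hB j i h).mpr h').symm

end SimpleGraph

/-! ### Shortest cycles and their pendant neighbors -/

namespace SimpleGraph

variable {V : Type*} {G : SimpleGraph V}

/-- A cycle of length `n`, as a periodic sequence of vertices. -/
structure IsPeriodicCycle (G : SimpleGraph V) (c : ℕ → V) (n : ℕ) : Prop where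
  three_le : 3 ≤ n
  periodic : ∀ i, c (i + n) = c i
  adj : ∀ i, G.Adj (c i) (c (i + 1))
  ne : ∀ i j, i < j → j < i + n → c i ≠ c j

theorem isPeriodicCycle_mod {g : ℕ → V} {m : ℕ} (hm : 3 ≤ m)
    (hinj : ∀ i j, i < j → j < m → g i ≠ g j) (hadj : ∀ i, i + 1 < m → G.Adj (g i) (g (i + 1)))
    (hlast : G.Adj (g (m - 1)) (g 0)) : G.IsPeriodicCycle (fun k => g (k % m)) m where
  three_le := hm
  periodic i := by simp
  adj i := by
    have hi : i % m < m := Nat.mod_lt _ (by omega)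
    rcases Nat.lt_or_ge (i % m + 1) m with h | h
    · have : (i + 1) % m = i % m + 1 := by
        rw [Nat.add_mod, Nat.mod_eq_of_lt (show 1 < m by omega), Nat.mod_eq_of_lt h]
      rw [this]
      exact hadj _ h
    · have h' : i % m = m - 1 := by omega
      have : (i + 1) % m = 0 := by
        rw [Nat.add_mod, Nat.mod_eq_of_lt (show 1 < m by omega), h', Nat.sub_add_cancel (by omega),
          Nat.mod_self]
      rw [this, h']
      exact hlast
  ne i j hij hj := by
    have hne : i % m ≠ j % m := by
      intro h
      have h1 := (Nat.modEq_iff_dvd' hij.le).mp h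
      have h2 := Nat.le_of_dvd (by omega) h1
      omega
    have hi : i % m < m := Nat.mod_lt _ (by omega)
    have hj : j % m < m := Nat.mod_lt _ (by omega)
    rcases Nat.lt_or_gt_of_ne hne with h | h
    · exact hinj _ _ h hj
    · exact (hinj _ _ h hi).symm

theorem exists_isPeriodicCycle_of_isCycle {u : V} (w : G.Walk u u) (hw : w.IsCycle) :
    G.IsPeriodicCycle (fun k => w.getVert (k % w.length)) w.length := by
  refine isPeriodicCycle_mod hw.three_le_length ?_ ?_ ?_
  · intro i j hij hj h
    have := hw.getVert_injOn' (by simp; omega) (by simp; omega) h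
    omega
  · intro i hi
    exact w.adj_getVert_succ (by omega)
  · have h3 := hw.three_le_length
    have := w.adj_getVert_succ (i := w.length - 1) (by omega)
    rw [Nat.sub_add_cancel (by omega), w.getVert_length] at this
    simpa using this

/-- A shortest cycle. -/
structure IsShortestCycle (G : SimpleGraph V) (c : ℕ → V) (n : ℕ) : Prop
    extends G.IsPeriodicCycle c n where
  le : ∀ m c', G.IsPeriodicCycle c' m → n ≤ m

namespace IsPeriodicCycle

variable {c : ℕ → V} {n : ℕ} (hc : G.IsPeriodicCycle c n)

include hc

theorem apply_add_mul (i k : ℕ) : c (i + n * k) = c i := by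
  induction k with
  | zero => simp
  | succ k ih => rw [Nat.mul_succ, ← add_assoc, hc.periodic, ih]

theorem apply_mod (i : ℕ) : c (i % n) = c i := by
  conv_rhs => rw [← Nat.mod_add_div i n]
  rw [hc.apply_add_mul]

theorem eq_add_of_mem_range {w : V} (hw : w ∈ Set.range c) (i : ℕ) : ∃ e < n, w = c (i + e) := by
  have h3 := hc.three_le
  obtain ⟨r, rfl⟩ := hw
  refine ⟨(r + n * (i + 1) - i) % n, Nat.mod_lt _ (by omega), ?_⟩
  have hle : i ≤ n * (i + 1) := by nlinarith
  have hdiv := Nat.mod_add_div (r + n * (i + 1) - i) n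
  rw [← hc.apply_add_mul (i + _) ((r + n * (i + 1) - i) / n), add_assoc, hdiv,
    ← hc.apply_add_mul r (i + 1)]
  congr 1
  omega

theorem shift (a : ℕ) : G.IsPeriodicCycle (fun k => c (a + k)) n where
  three_le := hc.three_le
  periodic i := by rw [← add_assoc, hc.periodic]
  adj i := by rw [← add_assoc]; exact hc.adj _
  ne i j hij hj := hc.ne _ _ (by omega) (by omega)

end IsPeriodicCycle

namespace IsShortestCycle

variable {c : ℕ → V} {n : ℕ} (hc : G.IsShortestCycle c n)

include hc

theorem le_of_inj {g : ℕ → V} {m : ℕ} (hm : 3 ≤ m)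
    (hinj : ∀ i j, i < j → j < m → g i ≠ g j) (hadj : ∀ i, i + 1 < m → G.Adj (g i) (g (i + 1)))
    (hlast : G.Adj (g (m - 1)) (g 0)) : n ≤ m :=
  hc.le _ _ (isPeriodicCycle_mod hm hinj hadj hlast)

theorem shift (a : ℕ) : G.IsShortestCycle (fun k => c (a + k)) n :=
  ⟨hc.toIsPeriodicCycle.shift a, hc.le⟩

theorem not_triangle (hn : 4 ≤ n) {u v w : V} (huv : G.Adj u v) (huw : G.Adj u w)
    (hvw : G.Adj v w) : False := by
  have := hc.le_of_inj (g := fun k => if k = 0 then u else if k = 1 then v else w) (m := 3) le_rfl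
    ?_ ?_ ?_
  · omega
  · intro a b hab hb
    interval_cases b <;> interval_cases a <;> simp [huv.ne, huw.ne, hvw.ne]
  · intro a ha
    have ha : a < 2 := by omega
    interval_cases a <;> simp [huv, hvw]
  · simpa using huw.symm

theorem not_adj {i d : ℕ} (h2 : 2 ≤ d) (hd : d + 2 ≤ n) : ¬G.Adj (c i) (c (i + d)) := by
  intro h
  have := hc.le_of_inj (g := fun k => c (i + k)) (m := d + 1) (by omega)
    (fun a b hab hb => hc.ne _ _ (by omega) (by omega)) (fun a _ => hc.adj _)
    (by simpa using h.symm)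
  omega

theorem le_add_two {i d : ℕ} (h1 : 1 ≤ d) (hd : d < n) {w : V} (hw : w ∉ Set.range c)
    (hi : G.Adj (c i) w) (hj : G.Adj (c (i + d)) w) : n ≤ d + 2 := by
  refine hc.le_of_inj (g := fun k => if k ≤ d then c (i + k) else w) (m := d + 2) (by omega) ?_ ?_ ?_
  · intro a b hab hb
    have ha : a ≤ d := by omega
    simp only [if_pos ha]
    split_ifs with hb'
    · exact hc.ne _ _ (by omega) (by omega)
    · exact fun h => hw ⟨_, h⟩
  · intro a ha
    have ha' : a ≤ d := by omega
    simp only [if_pos ha']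
    split_ifs with hb'
    · exact hc.adj _
    · obtain rfl : a = d := by omega
      exact hj
  · simpa using hi.symm

/-- Closing either arc between the two vertices through `w` gives n ≤ d + 2 and n ≤ (n - d) + 2,
hence n ≤ 4. -/
theorem not_adj_of_adj (hn : 5 ≤ n) {i d : ℕ} (h1 : 1 ≤ d) (hd : d < n) {w : V}
    (hw : w ∉ Set.range c) (hi : G.Adj (c i) w) : ¬G.Adj (c (i + d)) w := by
  intro hj
  have e1 := hc.le_add_two h1 hd hw hi hj
  have e2 := hc.le_add_two (i := i + d) (d := n - d) (by omega) (by omega) hw hj (by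
    rw [add_assoc, Nat.add_sub_cancel' hd.le, hc.periodic]
    exact hi)
  omega

theorem le_add_three {i d : ℕ} (hd : d < n) (h1 : 1 ≤ d) {w x : V} (hw : w ∉ Set.range c)
    (hx : x ∉ Set.range c)
    (hi : G.Adj (c i) w) (hj : G.Adj (c (i + d)) x) (hwx : G.Adj w x) : n ≤ d + 3 := by
  refine hc.le_of_inj (g := fun k => if k ≤ d then c (i + k) else if k = d + 1 then x else w)
    (m := d + 3) (by omega) ?_ ?_ ?_
  · intro a b hab hb
    rcases le_or_gt a d with ha | ha
    · simp only [if_pos ha]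
      split_ifs with hb' hb''
      · exact hc.ne _ _ (by omega) (by omega)
      · exact fun h => hx ⟨_, h⟩
      · exact fun h => hw ⟨_, h⟩
    · rw [if_neg (by omega), if_pos (by omega), if_neg (by omega), if_neg (by omega)]
      exact hwx.ne.symm
  · intro a ha
    rcases lt_trichotomy a d with h | h | h
    · rw [if_pos (by omega), if_pos (by omega)]
      exact hc.adj _
    · subst h
      simpa using hj
    · obtain rfl : a = d + 1 := by omega
      simpa using hwx.symm
  · simpa using hi.symm

/-- Vertices at distance at least three on a shortest cycle are not adjacent in the square. -/
theorem not_square_adj (hn : 5 ≤ n) {i d : ℕ} (h3 : 3 ≤ d) (hd : d + 3 ≤ n) :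
    ¬G.square.Adj (c i) (c (i + d)) := by
  rintro (h | ⟨-, w, hiw, hwj⟩)
  · exact hc.not_adj (by omega) (by omega) h
  · by_cases hw : w ∈ Set.range c
    · obtain ⟨e, he, rfl⟩ := hc.eq_add_of_mem_range hw i
      have e0 : e ≠ 0 := by
        rintro rfl
        exact G.irrefl hiw
      have e1 : e = 1 ∨ e + 1 = n := by
        by_contra hcon
        exact hc.not_adj (by omega) (by omega) hiw
      rcases e1 with rfl | e1
      · refine hc.not_adj (i := i + 1) (d := d - 1) (by omega) (by omega) ?_
        rwa [show i + 1 + (d - 1) = i + d by omega]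
      · refine hc.not_adj (i := i + d) (d := e - d) (by omega) (by omega) ?_
        rw [show i + d + (e - d) = i + e by omega]
        exact hwj.symm
    · exact hc.not_adj_of_adj hn (by omega) (by omega) hw hiw hwj.symm

/-- A neighbor of a vertex of a long shortest cycle is not adjacent in the square to the vertices
of the cycle at distance at least two. -/
theorem not_square_adj_pendant (hn : 7 ≤ n) {i d : ℕ} (h2 : 2 ≤ d) (hd : d + 2 ≤ n) {x : V}
    (hx : x ∉ Set.range c) (hix : G.Adj (c i) x) : ¬G.square.Adj x (c (i + d)) := by
  have hnot := fun e (h1 : 1 ≤ e) (he : e < n) => hc.not_adj_of_adj (by omega) h1 he hx hix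
  rintro (h | ⟨-, w, hxw, hwj⟩)
  · exact hnot d (by omega) (by omega) h.symm
  · by_cases hw : w ∈ Set.range c
    · obtain ⟨e, he, rfl⟩ := hc.eq_add_of_mem_range hw i
      rcases Nat.eq_zero_or_pos e with rfl | e0
      · exact hc.not_adj h2 hd hwj
      · exact hnot e e0 he hxw.symm
    -- The path through `x` and `w` closes both arcs: n ≤ d + 3 and n ≤ (n - d) + 3, so n ≤ 6.
    · have e1 := hc.le_add_three (by omega) (by omega) hx hw hix hwj.symm hxw
      have e2 := hc.le_add_three (i := i + d) (d := n - d) (by omega) (by omega) hw hx hwj.symm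
        (by rw [add_assoc, Nat.add_sub_cancel' (by omega), hc.periodic]; exact hix) hxw.symm
      omega

theorem ne_of_pendants (hn : 5 ≤ n) {i : ℕ} {x y : V} (hx : x ∉ Set.range c)
    (hix : G.Adj (c i) x) (hiy : G.Adj (c (i + 1)) y) : x ≠ y := by
  rintro rfl
  exact hc.not_adj_of_adj hn le_rfl (by omega) hx hix hiy

/-- Neighbors of adjacent vertices of a long shortest cycle are not adjacent in the square. -/
theorem not_square_adj_pendants (hn : 6 ≤ n) {i : ℕ} {x y : V} (hx : x ∉ Set.range c)
    (hy : y ∉ Set.range c) (hix : G.Adj (c i) x) (hiy : G.Adj (c (i + 1)) y) :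
    ¬G.square.Adj x y := by
  rintro (h | ⟨hne, w, hxw, hwy⟩)
  · have := hc.le_add_three (by omega) le_rfl hx hy hix hiy h
    omega
  · have hxw' := hxw.symm
    by_cases hw : w ∈ Set.range c
    · obtain ⟨e, he, rfl⟩ := hc.eq_add_of_mem_range hw i
      rcases Nat.eq_zero_or_pos e with rfl | e0
      · refine hc.not_adj_of_adj (i := i + 1) (d := n - 1) (by omega) (by omega) (by omega) hy hiy ?_
        rw [show i + 1 + (n - 1) = i + 0 + n by omega, hc.periodic]
        exact hwy
      · exact hc.not_adj_of_adj (by omega) e0 he hx hix hxw.symm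
    · have hnotw : ∀ k, c k ≠ w := fun k h => hw ⟨k, h⟩
      have hnotx : ∀ k, c k ≠ x := fun k h => hx ⟨k, h⟩
      have hnoty : ∀ k, c k ≠ y := fun k h => hy ⟨k, h⟩
      -- A common neighbor `w` off the cycle would complete a pentagon.
      have := hc.le_of_inj (g := fun k => if k = 0 then c i else if k = 1 then c (i + 1) else
        if k = 2 then y else if k = 3 then w else x) (m := 5) (by omega) ?_ ?_ ?_
      · omega
      · intro a b hab hb
        have h0 := hc.ne i (i + 1) (by omega) (by omega)
        interval_cases b <;> interval_cases a <;>
          simp [h0, hnotw, hnotx, hnoty, hne.symm, hwy.ne.symm, hxw.ne.symm]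
      · intro a ha
        have ha : a < 4 := by omega
        interval_cases a <;> simp [hc.adj, hiy, hwy.symm, hxw']
      · simpa using hix.symm

end IsShortestCycle

end SimpleGraph

/-! ### Shortest cycles of length at least seven -/

theorem mem_bandEdges_of_le (m : ℕ) : ∀ e ∈ bandEdges 0, e ∈ bandEdges m := by
  induction m with
  | zero => exact fun e he => he
  | succ m ih => exact fun e he => by simp [bandEdges, ih e he]

theorem mem_bandEdges_one (m k : ℕ) (hk : k + 4 ≤ m + 6) : (k + 3, k + 2) ∈ bandEdges m := by
  induction m with
  | zero =>
    have hk : k < 3 := by omega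
    interval_cases k <;> decide
  | succ m ih =>
    rcases Nat.lt_or_ge (k + 4) (m + 7) with h | h
    · simp [bandEdges, ih (by omega)]
    · obtain rfl : k = m + 3 := by omega
      simp [bandEdges]

theorem mem_bandEdges_two (m k : ℕ) (hk : k + 5 ≤ m + 6) : (k + 4, k + 2) ∈ bandEdges m := by
  induction m with
  | zero =>
    have hk : k < 2 := by omega
    interval_cases k <;> decide
  | succ m ih =>
    rcases Nat.lt_or_ge (k + 5) (m + 7) with h | h
    · simp [bandEdges, ih (by omega)]
    · obtain rfl : k = m + 2 := by omega
      simp [bandEdges]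

namespace SimpleGraph

variable {V : Type*} {G : SimpleGraph V} [Fintype V]

theorem exists_third_nbr (hcub : ∀ v, (G.nbr v).card = 3) {v a b : V} (hab : a ≠ b)
    (ha : G.Adj v a) (hb : G.Adj v b) :
    ∃ x, G.Adj v x ∧ x ≠ a ∧ x ≠ b ∧ ∀ w, G.Adj v w → w = a ∨ w = b ∨ w = x := by
  classical
  have h1 : (((G.nbr v).erase a).erase b).card = 1 := by
    rw [Finset.card_erase_of_mem (by simp [hab.symm, hb]), Finset.card_erase_of_mem (by simpa), hcub]
  obtain ⟨x, hx⟩ := Finset.card_eq_one.mp h1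
  have hmem : ∀ w, (w ≠ b ∧ w ≠ a ∧ G.Adj v w) ↔ w = x := fun w => by
    have := Finset.ext_iff.mp hx w
    simpa using this
  obtain ⟨hxb, hxa, hvx⟩ := (hmem x).mpr rfl
  refine ⟨x, hvx, hxa, hxb, fun w hw => ?_⟩
  by_contra! h
  exact h.2.2 ((hmem w).mp ⟨h.2.1, h.1, hw⟩)

/-- A shortest cycle of length at least seven, together with neighbors of two adjacent vertices, is
reducible. -/
theorem exists_coloring_of_long_cycle (hG : G.Connected) (hcub : ∀ v, (G.nbr v).card = 3)
    {c : ℕ → V} {n : ℕ} (hc : G.IsShortestCycle c n) (hn : 7 ≤ n) :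
    ∃ c : V → Fin 8, G.IsDistanceTwoColoring c := by
  have hthird : ∀ i, ∃ x, G.Adj (c (i + 1)) x ∧ x ∉ Set.range c := by
    intro i
    have hne := hc.ne i (i + 2) (by omega) (by omega)
    obtain ⟨x, hx, hx0, hx2, -⟩ := exists_third_nbr hcub hne (hc.adj i).symm (hc.adj (i + 1))
    refine ⟨x, hx, fun hr => ?_⟩
    obtain ⟨e, he, rfl⟩ := hc.eq_add_of_mem_range hr (i + 1)
    have e0 : e ≠ 0 := by
      rintro rfl
      exact G.irrefl hx
    have e1 : e = 1 ∨ e + 1 = n := by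
      by_contra hcon
      exact hc.not_adj (by omega) (by omega) hx
    rcases e1 with rfl | e1
    · exact hx2 rfl
    · apply hx0
      rw [show i + 1 + e = i + n by omega, hc.periodic]
  obtain ⟨x, hx, hxc⟩ := hthird 0
  obtain ⟨y, hy, hyc⟩ := hthird 1
  rw [zero_add] at hx
  norm_num at hy
  have hxy : x ≠ y := hc.ne_of_pendants (by omega) hxc hx hy
  have hxy2 : ¬G.square.Adj x y := hc.not_square_adj_pendants (by omega) hxc hyc hx hy
  have hcx : ∀ i, c i ≠ x := fun i h => hxc ⟨i, h⟩
  have hcy : ∀ i, c i ≠ y := fun i h => hyc ⟨i, h⟩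
  obtain ⟨m, rfl⟩ : ∃ m, n = m + 4 := ⟨n - 4, by omega⟩
  -- This is the numbering of `cycleEdges`: the pendants of `c 1` and `c 2` get 0 and 1, and `c k`
  -- gets `k + 2`.
  let F : ℕ → V := fun k => if k = 0 then x else if k = 1 then y else c (k - 2)
  have F0 : F 0 = x := rfl
  have F1 : F 1 = y := rfl
  have F2 : ∀ k, F (k + 2) = c k := fun k => by simp [F]
  have hinj : ∀ i j, i < j → j < m + 6 → F i ≠ F j := by
    intro i j hij hj
    rcases i with _ | _ | i
    · rcases j with _ | _ | j
      · omega
      · exact hxy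
      · rw [F2, F0]
        exact (hcx j).symm
    · rcases j with _ | _ | j
      · omega
      · omega
      · rw [F2, F1]
        exact (hcy j).symm
    · rcases j with _ | _ | j
      · omega
      · omega
      · rw [F2, F2]
        exact hc.ne _ _ (by omega) (by omega)
  have hadj : ∀ i j, i < j → j < m + 6 → G.square.Adj (F i) (F j) →
      (i, j) ∈ cycleEdges m ∨ (j, i) ∈ cycleEdges m := by
    intro i j hij hj h
    have hbase : ∀ e ∈ bandEdges 0, e ∈ cycleEdges m := fun e he => by
      simp [cycleEdges, mem_bandEdges_of_le m e he]
    rcases i with _ | _ | i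
    · rcases j with _ | _ | j
      · omega
      · exact absurd h hxy2
      · rw [F2, F0] at h
        have hj3 : j < 3 := by
          by_contra hj3
          refine hc.not_square_adj_pendant hn (i := 1) (d := j - 1) (by omega) (by omega) hxc hx ?_
          rwa [Nat.add_sub_cancel' (by omega)]
        left
        interval_cases j <;> exact hbase _ (by decide)
    · rcases j with _ | _ | j
      · omega
      · omega
      · rw [F2, F1] at h
        have hj3 : 1 ≤ j ∧ j < 4 := by
          by_contra hj3
          rcases Nat.eq_zero_or_pos j with rfl | hj0
          · refine hc.not_square_adj_pendant hn (i := 2) (d := m + 2) (by omega) (by omega) hyc hy ?_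
            rwa [show 2 + (m + 2) = 0 + (m + 4) by omega, hc.periodic]
          · refine hc.not_square_adj_pendant hn (i := 2) (d := j - 2) (by omega) (by omega) hyc hy ?_
            rwa [Nat.add_sub_cancel' (by omega)]
        left
        obtain ⟨hj1, hj3⟩ := hj3
        interval_cases j <;> exact hbase _ (by decide)
    · rcases j with _ | _ | j
      · omega
      · omega
      · rw [F2, F2] at h
        have hd : j - i < 3 ∨ m + 2 ≤ j - i := by
          by_contra hd
          refine hc.not_square_adj (by omega) (i := i) (d := j - i) (by omega) (by omega) ?_
          rwa [Nat.add_sub_cancel' (by omega)]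
        right
        have hcase : j = i + 1 ∨ j = i + 2 ∨ (i = 0 ∧ j = m + 3) ∨ (i = 1 ∧ j = m + 3) ∨
          (i = 0 ∧ j = m + 2) := by omega
        rcases hcase with rfl | rfl | ⟨rfl, rfl⟩ | ⟨rfl, rfl⟩ | ⟨rfl, rfl⟩
        · simp [cycleEdges, mem_bandEdges_one m i (by omega)]
        · simp [cycleEdges, mem_bandEdges_two m i (by omega)]
        · simp [cycleEdges]
        · simp [cycleEdges]
        · simp [cycleEdges]
  obtain ⟨L, hL, hcount⟩ := exists_signedCount_cycleEdges_ne_zero m (by omega)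
  -- The positions have at least 3, 3, 5, 6, 6, 5, 4, 4, … square-neighbors within the set, and
  -- every exponent is at most this number minus two.
  have hLb : ∀ k, L.getD k 2 ≤ [1, 1, 3, 3, 4, 3, 2, 2].getD k 2 := by
    intro k
    simp only [List.mem_cons, List.not_mem_nil, or_false] at hL
    rcases Nat.lt_or_ge k 8 with hk | hk
    · rcases hL with rfl | rfl <;> interval_cases k <;> decide
    · rcases hL with rfl | rfl <;>
        rw [List.getD_eq_default _ _ (by simpa using hk), List.getD_eq_default _ _ (by simpa using hk)]
  have hdeg : ∀ v, (G.nbr v).card ≤ 3 := fun v => (hcub v).le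
  let lab : ℕ → Fin (m + 6) := fun k => ⟨k % (m + 4) + 2, by have := Nat.mod_lt k (show 0 < m + 4 by omega); omega⟩
  have hlab : ∀ k, F (lab k) = c k := fun k => (F2 _).trans (hc.apply_mod k)
  have hlabne : ∀ i j, i < j → j < i + (m + 4) → lab i ≠ lab j := by
    intro i j hij hj h
    apply hc.ne i j hij hj
    rw [← hlab, h, hlab]
  have hlist : ∀ (i : Fin (m + 6)) (l : List (Fin (m + 6))), l.Nodup →
      (∀ j ∈ l, G.square.Adj (F i) (F j)) → bandExp (fun k => L.getD k 2) m 2 2 i + 2 ≤ l.length →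
      ∃ s : Finset (Fin (m + 6)), (∀ j ∈ s, G.square.Adj (F i) (F j)) ∧
      bandExp (fun k => L.getD k 2) m 2 2 i + 1 + (G.square.nbr (F i)).card ≤ s.card + 8 := by
    intro i l hl hl' hlen
    refine ⟨l.toFinset, by simpa using hl', ?_⟩
    have := card_square_nbr_le hdeg (F i)
    rw [List.toFinset_card_of_nodup hl]
    omega
  have hexp : ∀ k, bandExp (fun k => L.getD k 2) m 2 2 k ≤
      max ([1, 1, 3, 3, 4, 3, 2, 2].getD k 2) 2 := by
    intro k
    rw [bandExp]
    split_ifs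
    · exact (hLb k).trans (le_max_left _ _)
    all_goals simp
  have hexp01 : ∀ k < 2, bandExp (fun k => L.getD k 2) m 2 2 k + 2 ≤ 3 := by
    intro k hk
    rw [bandExp, if_pos (by omega)]
    have := hLb k
    interval_cases k <;> simp at this ⊢ <;> omega
  let N : ℕ → List (Fin (m + 6)) := fun k => [k + 1, k + 2, k + (m + 2), k + (m + 3)].map lab
  have hN : ∀ k, (N k).Nodup := by
    intro k
    refine List.Nodup.map_on ?_ (by simp; omega)
    intro a ha b hb hab
    simp only [List.mem_cons, List.not_mem_nil, or_false] at ha hb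
    by_contra hne
    rcases Nat.lt_or_gt_of_ne hne with h | h
    · exact hlabne a b h (by omega) hab
    · exact hlabne b a h (by omega) hab.symm
  have hlabsq : ∀ k, G.square.Adj (c k) (c (k + 1)) ∧ G.square.Adj (c k) (c (k + 2)) := fun k =>
    ⟨(hc.adj k).square, square_adj_of_adj_adj (hc.adj k) (hc.adj (k + 1))
      (hc.ne _ _ (by omega) (by omega))⟩
  have hNadj : ∀ k, ∀ j ∈ N k, G.square.Adj (F (k + 2)) (F j) := by
    intro k j hj
    simp only [N, List.map_cons, List.map_nil, List.mem_cons, List.not_mem_nil, or_false] at hj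
    rw [F2]
    rcases hj with rfl | rfl | rfl | rfl <;> rw [hlab]
    · exact (hlabsq k).1
    · exact (hlabsq k).2
    · have := (hlabsq (k + (m + 2))).2
      rw [show k + (m + 2) + 2 = k + (m + 4) by omega, hc.periodic] at this
      exact this.symm
    · have := (hlabsq (k + (m + 3))).1
      rw [show k + (m + 3) + 1 = k + (m + 4) by omega, hc.periodic] at this
      exact this.symm
  have hlabval : ∀ k, ((lab k : Fin (m + 6)) : ℕ) = k % (m + 4) + 2 := fun k => rfl
  have hNval : ∀ k, ∀ j ∈ N k, 2 ≤ (j : ℕ) := by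
    intro k j hj
    simp only [N, List.map_cons, List.map_nil, List.mem_cons, List.not_mem_nil, or_false] at hj
    rcases hj with rfl | rfl | rfl | rfl <;> simp [hlabval]
  let z : Fin (m + 6) := ⟨0, by omega⟩
  let o : Fin (m + 6) := ⟨1, by omega⟩
  have hzN : ∀ k, z ∉ N k := fun k h => absurd (hNval k _ h) (by simp [z])
  have hoN : ∀ k, o ∉ N k := fun k h => absurd (hNval k _ h) (by simp [o])
  have hzo : z ≠ o := by simp [z, o]
  have hxs : ∀ j ≤ 2, G.square.Adj (F (j + 2)) (F z) := by
    intro j hj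
    rw [F2]
    change G.square.Adj _ x
    interval_cases j
    · exact square_adj_of_adj_adj (hc.adj 0) hx (hcx 0)
    · exact hx.square
    · exact square_adj_of_adj_adj (hc.adj 1).symm hx (hcx 2)
  have hys : ∀ j, 1 ≤ j → j ≤ 3 → G.square.Adj (F (j + 2)) (F o) := by
    intro j hj hj'
    rw [F2]
    change G.square.Adj _ y
    interval_cases j
    · exact square_adj_of_adj_adj (hc.adj 1) hy (hcy 1)
    · exact hy.square
    · exact square_adj_of_adj_adj (hc.adj 2).symm hy (hcy 3)
  have hlablt : ∀ k < m + 4, ((lab k : Fin (m + 6)) : ℕ) = k + 2 := fun k hk => by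
    rw [hlabval, Nat.mod_eq_of_lt hk]
  have hlab3 : ∀ k, [lab k, lab (k + 1), lab (k + 2)].Nodup := by
    intro k
    have h1 := hlabne k (k + 1) (by omega) (by omega)
    have h2 := hlabne k (k + 2) (by omega) (by omega)
    have h3 := hlabne (k + 1) (k + 2) (by omega) (by omega)
    simp [h1, h2, h3]
  refine exists_coloring_of_signedCount hG hdeg (fun i : Fin (m + 6) => F i) ?_ (cycleEdges m)
    (bandExp (fun k => L.getD k 2) m 2 2) ?_ ?_ hcount ?_ (lab 0) (lab 1) ?_
  · intro i j h
    by_contra hne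
    rcases lt_or_gt_of_ne hne with h' | h'
    · exact hinj i j h' j.2 h
    · exact hinj j i h' i.2 h.symm
  · intro i j h
    have hne : i ≠ j := by
      rintro rfl
      exact G.square.irrefl h
    rcases lt_or_gt_of_ne hne with h' | h'
    · exact hadj i j h' j.2 h
    · exact (hadj j i h' i.2 h.symm).symm
  · intro k hk
    rw [bandExp, if_neg (by omega), if_neg (by omega), if_neg (by omega)]
  · intro i
    obtain ⟨i, hi⟩ := i
    have hb := hexp i
    rcases i with _ | _ | i
    · refine hlist ⟨0, hi⟩ [lab 0, lab 1, lab 2] (hlab3 0) ?_ (hexp01 0 (by omega))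
      intro j hj
      simp only [List.mem_cons, List.not_mem_nil, or_false] at hj
      rcases hj with rfl | rfl | rfl <;> rw [hlablt _ (by omega)] <;> exact (hxs _ (by omega)).symm
    · refine hlist ⟨1, hi⟩ [lab 1, lab 2, lab 3] (hlab3 1) ?_ (hexp01 1 (by omega))
      intro j hj
      simp only [List.mem_cons, List.not_mem_nil, or_false] at hj
      rcases hj with rfl | rfl | rfl <;> rw [hlablt _ (by omega)] <;>
        exact (hys _ (by omega) (by omega)).symm
    · rcases Nat.lt_or_ge i 4 with hi4 | hi4
      · interval_cases i
        · exact hlist ⟨2, hi⟩ (z :: N 0) (List.nodup_cons.mpr ⟨hzN _, hN _⟩)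
            (List.forall_mem_cons.mpr ⟨hxs 0 (by omega), hNadj 0⟩) (by simpa [N] using hb)
        · exact hlist ⟨3, hi⟩ (z :: o :: N 1) (List.nodup_cons.mpr ⟨by simp [hzo, hzN],
            List.nodup_cons.mpr ⟨hoN _, hN _⟩⟩) (List.forall_mem_cons.mpr ⟨hxs 1 (by omega),
            List.forall_mem_cons.mpr ⟨hys 1 (by omega) (by omega), hNadj 1⟩⟩)
            ((Nat.add_le_add_right hb 2).trans (by simp [N]))
        · exact hlist ⟨4, hi⟩ (z :: o :: N 2) (List.nodup_cons.mpr ⟨by simp [hzo, hzN],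
            List.nodup_cons.mpr ⟨hoN _, hN _⟩⟩) (List.forall_mem_cons.mpr ⟨hxs 2 (by omega),
            List.forall_mem_cons.mpr ⟨hys 2 (by omega) (by omega), hNadj 2⟩⟩)
            ((Nat.add_le_add_right hb 2).trans (by simp [N]))
        · exact hlist ⟨5, hi⟩ (o :: N 3) (List.nodup_cons.mpr ⟨hoN _, hN _⟩)
            (List.forall_mem_cons.mpr ⟨hys 3 (by omega) (by omega), hNadj 3⟩)
            ((Nat.add_le_add_right hb 2).trans (by simp [N]))
      · refine hlist ⟨i + 2, hi⟩ (N i) (hN _) (hNadj i) ((Nat.add_le_add_right hb 2).trans ?_)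
        rcases Nat.lt_or_ge i 6 with hi6 | hi6
        · interval_cases i <;> simp [N]
        · rw [List.getD_eq_default _ _ (by simpa using hi6)]
          simp [N]
  · rw [hlab, hlab]
    exact hc.adj 0

end SimpleGraph

/-! ### Vertices of small degree, triangles, and shortest cycles of length six -/

namespace SimpleGraph

variable {V : Type*} {G : SimpleGraph V} [Fintype V]

theorem exists_other_nbrs (hcub : ∀ v, (G.nbr v).card = 3) {v a : V} (ha : G.Adj v a) :
    ∃ x y, ∀ w, G.Adj v w → w = a ∨ w = x ∨ w = y := by
  classical
  have h1 : ((G.nbr v).erase a).card = 2 := by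
    rw [Finset.card_erase_of_mem (by simpa using ha), hcub]
  obtain ⟨x, y, -, hxy⟩ := Finset.card_eq_two.mp h1
  refine ⟨x, y, fun w hw => ?_⟩
  have := Finset.ext_iff.mp hxy w
  simp only [Finset.mem_erase, mem_nbr, hw, and_true, Finset.mem_insert,
    Finset.mem_singleton] at this
  tauto

theorem card_square_nbr_le_length {v : V} (L : List V)
    (h : ∀ w, G.Adj v w → w ∈ L ∧ ∀ z, G.Adj w z → z = v ∨ z ∈ L) :
    (G.square.nbr v).card ≤ L.length := by
  classical
  refine (Finset.card_le_card (t := L.toFinset) fun w hw => ?_).trans L.toFinset_card_le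
  rw [List.mem_toFinset]
  rcases mem_nbr.mp hw with h' | ⟨hne, u, hvu, huw⟩
  · exact (h w h').1
  · exact ((h u hvu).2 w huw).resolve_left hne.symm

/-- The reducible set is the edge `u`, `v`: with at most 8 and 6 square-neighbors, its ends keep at
least 1 and 3 colors. -/
theorem exists_coloring_of_card_nbr_le_two (hG : G.Connected) (hdeg : ∀ v, (G.nbr v).card ≤ 3)
    {v u : V} (hv : (G.nbr v).card ≤ 2) (hvu : G.Adj v u) :
    ∃ c : V → Fin 8, G.IsDistanceTwoColoring c := by
  classical
  have h1 : (G.square.nbr v).card ≤ 6 := by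
    refine (card_square_nbr_le_sum v).trans ((Finset.sum_le_card_nsmul _ _ 3 fun w _ => hdeg w).trans ?_)
    rw [smul_eq_mul]
    omega
  have h2 : (G.square.nbr u).card ≤ 8 := by
    refine (card_square_nbr_le_sum u).trans ?_
    have hm : v ∈ G.nbr u := mem_nbr.mpr hvu.symm
    rw [← Finset.add_sum_erase _ _ hm]
    have := Finset.sum_le_card_nsmul ((G.nbr u).erase v) (fun w => (G.nbr w).card) 3
      fun w _ => hdeg w
    rw [Finset.card_erase_of_mem hm, smul_eq_mul] at this
    have := hdeg u
    omega
  refine exists_coloring_of_listCount hG hdeg (M := 2) ![u, v] ?_ (fun _ _ => true) ?_ ![8, 6] ?_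
    [0, 1] (by decide) 0 1 hvu.symm
  · intro i j h
    have := hvu.ne
    fin_cases i <;> fin_cases j <;> simp_all
  · have := hvu.symm.square
    intro i j hij
    fin_cases i <;> fin_cases j <;> simp_all [G.square.adj_comm]
  · intro i
    fin_cases i
    · exact h2
    · exact h1

theorem card_square_nbr_le_of_triangle (hcub : ∀ v, (G.nbr v).card = 3) {u v w : V}
    (huv : G.Adj u v) (huw : G.Adj u w) (hvw : G.Adj v w) : (G.square.nbr u).card ≤ 7 := by
  obtain ⟨x, hx, -, -, hu'⟩ := exists_third_nbr hcub hvw.ne huv huw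
  obtain ⟨y, -, -, -, hv'⟩ := exists_third_nbr hcub huw.ne huv.symm hvw
  obtain ⟨z, -, -, -, hw'⟩ := exists_third_nbr hcub huv.ne huw.symm hvw.symm
  obtain ⟨r, s, hx'⟩ := exists_other_nbrs hcub hx.symm
  refine card_square_nbr_le_length [v, w, x, y, z, r, s] fun a ha => ?_
  rcases hu' a ha with rfl | rfl | rfl
  · refine ⟨by simp, fun b hb => ?_⟩
    have := hv' b hb
    simp only [List.mem_cons]
    tauto
  · refine ⟨by simp, fun b hb => ?_⟩
    have := hw' b hb
    simp only [List.mem_cons]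
    tauto
  · refine ⟨by simp, fun b hb => ?_⟩
    have := hx' b hb
    simp only [List.mem_cons]
    tauto

/-- Each vertex of the triangle has at most 7 square-neighbors, two of them in the triangle, and so
keeps at least three colors. -/
theorem exists_coloring_of_triangle (hG : G.Connected) (hcub : ∀ v, (G.nbr v).card = 3)
    {u v w : V} (huv : G.Adj u v) (huw : G.Adj u w) (hvw : G.Adj v w) :
    ∃ c : V → Fin 8, G.IsDistanceTwoColoring c := by
  refine exists_coloring_of_listCount hG (fun v => (hcub v).le) (M := 3) ![u, v, w] ?_
    (fun _ _ => true) ?_ ![7, 7, 7] ?_ [0, 1, 2] (by decide) 0 1 huv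
  · have h1 := huv.ne
    have h2 := huw.ne
    have h3 := hvw.ne
    intro i j h
    fin_cases i <;> fin_cases j <;> simp_all
  · have h1 := huv.square
    have h2 := huw.square
    have h3 := hvw.square
    intro i j hij
    fin_cases i <;> fin_cases j <;> simp_all [G.square.adj_comm]
  · intro i
    fin_cases i
    · exact card_square_nbr_le_of_triangle hcub huv huw hvw
    · exact card_square_nbr_le_of_triangle hcub huv.symm hvw huw
    · exact card_square_nbr_le_of_triangle hcub huw.symm hvw.symm huv

/-- `x i` is the neighbor outside the cycle `c` of the vertex `c i`. -/
structure IsPendants (G : SimpleGraph V) (c : ℕ → V) (n : ℕ) (x : ℕ → V) : Prop where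
  periodic : ∀ i, x (i + n) = x i
  not_mem : ∀ i, x i ∉ Set.range c
  adj : ∀ i, G.Adj (c i) (x i)
  eq : ∀ i w, G.Adj (c i) w → w = c (i + 1) ∨ w = c (i + (n - 1)) ∨ w = x i

namespace IsShortestCycle

variable {c : ℕ → V} {n : ℕ} (hc : G.IsShortestCycle c n)

include hc

theorem exists_isPendants (hcub : ∀ v, (G.nbr v).card = 3) :
    ∃ x, G.IsPendants c n x := by
  have h3 := hc.three_le
  have hpred : ∀ i, G.Adj (c i) (c (i + (n - 1))) := by
    intro i
    have := hc.adj (i + (n - 1))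
    rw [show i + (n - 1) + 1 = i + n by omega, hc.periodic] at this
    exact this.symm
  have hex : ∀ i, ∃ x, G.Adj (c i) x ∧ x ∉ Set.range c ∧
      ∀ w, G.Adj (c i) w → w = c (i + 1) ∨ w = c (i + (n - 1)) ∨ w = x := by
    intro i
    obtain ⟨x, hx, h1, h2, h⟩ := exists_third_nbr hcub
      (hc.ne (i + 1) (i + (n - 1)) (by omega) (by omega)) (hc.adj i) (hpred i)
    refine ⟨x, hx, fun hr => ?_, h⟩
    obtain ⟨e, he, rfl⟩ := hc.eq_add_of_mem_range hr i
    have e0 : e ≠ 0 := by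
      rintro rfl
      exact G.irrefl hx
    have e1 : e ≠ 1 := by
      rintro rfl
      exact h1 rfl
    have e2 : e ≠ n - 1 := by
      rintro rfl
      exact h2 rfl
    exact hc.not_adj (by omega) (by omega) hx
  choose x hx using hex
  -- Choosing only on residues modulo `n` makes the pendants periodic.
  refine ⟨fun i => x (i % n), fun i => by simp, fun i => (hx _).2.1,
    fun i => hc.apply_mod i ▸ (hx (i % n)).1, fun i w hw => ?_⟩
  rw [← hc.apply_mod] at hw
  rw [← hc.apply_mod (i + 1), ← hc.apply_mod (i + (n - 1)), Nat.add_mod i 1, Nat.add_mod i (n - 1)]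
  have := (hx (i % n)).2.2 w hw
  rw [← hc.apply_mod (i % n + 1), ← hc.apply_mod (i % n + (n - 1))] at this
  rwa [Nat.add_mod, Nat.mod_mod, Nat.add_mod (i % n) (n - 1), Nat.mod_mod] at this

/-- The square restricted to the hexagon is the octahedron: exactly opposite vertices are
nonadjacent. All exponents are 4 - 2 = 2. -/
theorem exists_coloring_of_length_six (hG : G.Connected) (hcub : ∀ v, (G.nbr v).card = 3)
    (hn : n = 6) : ∃ c : V → Fin 8, G.IsDistanceTwoColoring c := by
  subst hn
  have hdeg : ∀ v, (G.nbr v).card ≤ 3 := fun v => (hcub v).le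
  refine exists_coloring_of_listCount hG hdeg (M := 6) (fun i => c i) ?_
    (fun i j => i != j + 3) ?_ (fun _ => 9) (fun i => card_square_nbr_le hdeg _) [2, 2, 2, 2, 2, 2]
    (by decide +kernel) 0 1 (hc.adj 0)
  · intro i j h
    by_contra hne
    rcases lt_or_gt_of_ne hne with h' | h'
    · exact hc.ne i j h' (by omega) h
    · exact hc.ne j i h' (by omega) h.symm
  · have hadj2 : ∀ i, G.square.Adj (c i) (c (i + 2)) := fun i =>
      square_adj_of_adj_adj (hc.adj i) (hc.adj (i + 1)) (hc.ne _ _ (by omega) (by omega))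
    intro i j hij
    obtain ⟨i, hi⟩ := i
    obtain ⟨j, hj⟩ := j
    obtain ⟨d, rfl⟩ := Nat.exists_eq_add_of_lt (show j < i from hij)
    rw [G.square.adj_comm]
    by_cases hd : d = 2
    · subst hd
      exact iff_of_false (hc.not_square_adj (by omega) (i := j) (d := 3) (by omega) (by omega)) (by simp)
    · refine iff_of_true ?_ (by simp; omega)
      have hd : d = 0 ∨ d = 1 ∨ d = 3 ∨ d = 4 := by omega
      rcases hd with rfl | rfl | rfl | rfl
      · exact (hc.adj j).square
      · exact hadj2 j
      · have := hadj2 (j + 4)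
        rw [show j + 4 + 2 = j + 6 by omega, hc.periodic] at this
        exact this.symm
      · have := (hc.adj (j + 5)).square
        rw [show j + 5 + 1 = j + 6 by omega, hc.periodic] at this
        exact this.symm

end IsShortestCycle

end SimpleGraph

/-! ### Pendants and shortest cycles of length five -/

namespace SimpleGraph

variable {V : Type*} {G : SimpleGraph V} {c : ℕ → V} {n : ℕ} {x : ℕ → V}

namespace IsPendants

variable (hc : G.IsShortestCycle c n) (hx : G.IsPendants c n x)

include hx in
theorem shift (a : ℕ) : G.IsPendants (fun k => c (a + k)) n (fun k => x (a + k)) where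
  periodic i := by rw [← add_assoc, hx.periodic]
  not_mem i := fun ⟨k, hk⟩ => hx.not_mem _ ⟨_, hk⟩
  adj i := hx.adj _
  eq i w hw := by simpa only [add_assoc] using hx.eq (a + i) w hw

include hx in
theorem ne_cycle (i j : ℕ) : x i ≠ c j := fun h => hx.not_mem i ⟨j, h.symm⟩

include hx in
theorem square_adj_self (i : ℕ) : G.square.Adj (x i) (c i) := (hx.adj i).symm.square

include hc in
theorem pred_adj (i : ℕ) : G.Adj (c i) (c (i + (n - 1))) := by
  have := hc.adj (i + (n - 1))
  rw [add_assoc, Nat.sub_add_cancel (by have := hc.three_le; omega), hc.periodic] at this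
  exact this.symm

include hc hx

theorem square_adj_succ (i : ℕ) : G.square.Adj (x i) (c (i + 1)) :=
  square_adj_of_adj_adj (hx.adj i).symm (hc.adj i) (hx.ne_cycle _ _)

theorem square_adj_pred (i : ℕ) : G.square.Adj (x i) (c (i + (n - 1))) :=
  square_adj_of_adj_adj (hx.adj i).symm (pred_adj hc i) (hx.ne_cycle _ _)

theorem ne_succ (hn : 4 ≤ n) (i : ℕ) : x i ≠ x (i + 1) := by
  intro h
  have := hc.le_add_two le_rfl (by omega) (hx.not_mem i) (hx.adj i) (h ▸ hx.adj (i + 1))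
  omega

theorem ne (hn : 5 ≤ n) {i d : ℕ} (h1 : 1 ≤ d) (hd : d < n) : x i ≠ x (i + d) := fun h =>
  hc.not_adj_of_adj hn h1 hd (hx.not_mem i) (hx.adj i) (h ▸ hx.adj (i + d))

/-- A common neighbor would be a neighbor of `c (i + d)`. Its two neighbors on the cycle are
excluded, since `x i` has only one neighbor there; its pendant remains. -/
theorem square_adj_iff (hn : 5 ≤ n) {i d : ℕ} (h2 : 2 ≤ d) (hd : d + 2 ≤ n) :
    G.square.Adj (x i) (c (i + d)) ↔ G.Adj (x i) (x (i + d)) := by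
  have hnot := fun e (h1 : 1 ≤ e) (he : e < n) =>
    hc.not_adj_of_adj hn h1 he (hx.not_mem i) (hx.adj i)
  refine ⟨?_, fun h => square_adj_of_adj_adj h (hx.adj _).symm (hx.ne_cycle _ _)⟩
  rintro (h | ⟨-, w, hw, hw'⟩)
  · exact absurd h.symm (hnot d (by omega) (by omega))
  · rcases hx.eq _ w hw'.symm with rfl | rfl | rfl
    · exact absurd hw.symm (hnot (d + 1) (by omega) (by omega))
    · rw [show i + d + (n - 1) = i + (d - 1) + n by omega, hc.periodic] at hw
      exact absurd hw.symm (hnot (d - 1) (by omega) (by omega))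
    · exact hw

end IsPendants

namespace IsShortestCycle

theorem square_adj_of_length_five (hc : G.IsShortestCycle c 5) {i j : ℕ} (hij : i < j) (hj : j < 5) :
    G.square.Adj (c j) (c i) := by
  have hadj2 : ∀ i, G.square.Adj (c i) (c (i + 2)) := fun i =>
    square_adj_of_adj_adj (hc.adj i) (hc.adj (i + 1)) (hc.ne _ _ (by omega) (by omega))
  obtain ⟨d, rfl⟩ := Nat.exists_eq_add_of_lt hij
  have hd : d = 0 ∨ d = 1 ∨ d = 2 ∨ d = 3 := by omega
  rcases hd with rfl | rfl | rfl | rfl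
  · exact (hc.adj i).square.symm
  · exact (hadj2 i).symm
  · have := hadj2 (i + 3)
    rwa [show i + 3 + 2 = i + 5 by omega, hc.periodic] at this
  · have := (hc.adj (i + 4)).square
    rwa [show i + 4 + 1 = i + 5 by omega, hc.periodic] at this

variable [Fintype V]

/-- The square of a cycle of length five together with the neighbors of two nonconsecutive vertices
of it. -/
def fiveTwo (a b h : Bool) (i j : ℕ) : Bool :=
  (([[], [true], [true, true], [true, true, true], [true, true, true, true],
    [true, true, false, b, true], [false, true, true, true, a, h]].getD i []).getD j false)

theorem exists_coloring_of_fiveTwo (hG : G.Connected) (hcub : ∀ v, (G.nbr v).card = 3)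
    (hc : G.IsShortestCycle c 5) (hx : G.IsPendants c 5 x) (h02 : ¬G.Adj (x 0) (x 2))
    (h : G.Adj (x 2) (x 4) ∨ G.Adj (x 0) (x 3) ∨ G.square.Adj (x 2) (x 0)) :
    ∃ c : V → Fin 8, G.IsDistanceTwoColoring c := by
  classical
  have hdeg : ∀ v, (G.nbr v).card ≤ 3 := fun v => (hcub v).le
  have e5 : ∀ {i j : ℕ}, i < j → j < 5 → G.square.Adj (c j) (c i) := hc.square_adj_of_length_five
  have s00 := hx.square_adj_self 0
  have s01 := IsPendants.square_adj_succ hc hx 0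
  have s04 := IsPendants.square_adj_pred hc hx 0
  have s22 := hx.square_adj_self 2
  have s23 := IsPendants.square_adj_succ hc hx 2
  have s21 := IsPendants.square_adj_pred hc hx 2
  have s02 := IsPendants.square_adj_iff hc hx le_rfl (i := 0) (d := 2) le_rfl (by omega)
  have s03 := IsPendants.square_adj_iff hc hx le_rfl (i := 0) (d := 3) (by omega) (by omega)
  have s24 := IsPendants.square_adj_iff hc hx le_rfl (i := 2) (d := 2) le_rfl (by omega)
  have s20 := IsPendants.square_adj_iff hc hx le_rfl (i := 2) (d := 3) (by omega) (by omega)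
  have c5 : c 5 = c 0 := hc.periodic 0
  have c6 : c 6 = c 1 := hc.periodic 1
  have x5 : x 5 = x 0 := hx.periodic 0
  have n02 : x 2 ≠ x 0 := (IsPendants.ne hc hx le_rfl (i := 0) (d := 2) (by omega) (by omega)).symm
  norm_num [c5, c6, x5] at s01 s04 s23 s21 s02 s03 s24 s20
  rw [G.adj_comm] at s20
  -- Only three adjacencies of the square on the cycle, `x 0` and `x 2` are undetermined. Each of
  -- the seven combinations allowed by `h` has its own exponents.
  obtain ⟨a, ha⟩ : ∃ a : Bool, G.Adj (x 2) (x 4) ↔ a = true := ⟨_, decide_eq_true_iff.symm⟩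
  obtain ⟨b, hb⟩ : ∃ a : Bool, G.Adj (x 0) (x 3) ↔ a = true := ⟨_, decide_eq_true_iff.symm⟩
  obtain ⟨d, hd⟩ : ∃ a : Bool, G.square.Adj (x 2) (x 0) ↔ a = true := ⟨_, decide_eq_true_iff.symm⟩
  have hcheck : ∃ t : List ℕ, t.length = 7 ∧ listCount (edgesOf 7 (fiveTwo a b d)) t ≠ 0 ∧
      ∀ i : Fin 7, t.getD i 0 + 1 + 9 ≤ (Finset.univ.filter fun j : Fin 7 =>
        j < i ∧ fiveTwo a b d i j = true ∨ i < j ∧ fiveTwo a b d j i = true).card + 8 := by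
    rw [ha, hb, hd] at h
    clear ha hb hd
    revert a b d
    rintro (_ | _) (_ | _) (_ | _) h
    · simp at h
    · exact ⟨[1, 4, 2, 3, 3, 2, 2], by decide +kernel⟩
    · exact ⟨[1, 3, 3, 4, 3, 2, 1], by decide +kernel⟩
    · exact ⟨[0, 3, 3, 4, 3, 3, 2], by decide +kernel⟩
    · exact ⟨[3, 3, 1, 3, 4, 1, 2], by decide +kernel⟩
    · exact ⟨[3, 3, 0, 3, 4, 2, 3], by decide +kernel⟩
    · exact ⟨[3, 2, 3, 3, 4, 1, 2], by decide +kernel⟩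
    · exact ⟨[3, 0, 3, 3, 4, 3, 3], by decide +kernel⟩
  obtain ⟨t, hcheck⟩ := hcheck
  refine exists_coloring_of_listCount hG hdeg ![c 0, c 1, c 2, c 3, c 4, x 0, x 2] ?_
    (fiveTwo a b d) ?_ (fun _ => 9) (fun i => card_square_nbr_le hdeg _) t hcheck 0 1 (hc.adj 0)
  · have hne : ∀ i j, x i ≠ c j := hx.ne_cycle
    have hne' : ∀ i j, c j ≠ x i := fun i j => (hne i j).symm
    have hcc : ∀ i j, i < j → j < 5 → c i ≠ c j := fun i j h1 h2 => hc.ne i j h1 (by omega)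
    intro i j h
    fin_cases i <;> fin_cases j <;>
      first
        | rfl
        | exact absurd h (hne _ _)
        | exact absurd h (hne' _ _)
        | exact absurd h (hcc _ _ (by decide) (by decide))
        | exact absurd h.symm (hcc _ _ (by decide) (by decide))
        | exact absurd h n02
        | exact absurd h n02.symm
  · intro i j hij
    fin_cases i <;> fin_cases j <;>
      first
        | exact absurd hij (by decide)
        | exact iff_of_true (e5 (by decide) (by decide)) rfl
        | exact iff_of_true (by assumption) rfl
        | exact s03.trans hb
        | exact s24.trans ha
        | exact hd
        | exact iff_of_false (fun h => h02 (s02.mp h)) Bool.false_ne_true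
        | exact iff_of_false (fun h => h02 (s20.mp h)) Bool.false_ne_true

end IsShortestCycle

end SimpleGraph

namespace SimpleGraph

variable {V : Type*} {G : SimpleGraph V} {c : ℕ → V} {n : ℕ} {x : ℕ → V} [Fintype V]

namespace IsShortestCycle

/-- The square of a cycle of length five together with the neighbors of three consecutive vertices
of it. -/
def fiveThree (a b : Bool) (i j : ℕ) : Bool :=
  (([[], [true], [true, true], [true, true, true], [true, true, true, true],
    [true, true, false, false, true], [true, true, true, false, false, a],
    [true, false, false, true, true, b, false]].getD i []).getD j false)

/-- Here the pendants of three consecutive vertices 4, 0, 1 are added to the pentagon; only the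
square-adjacency of `x 0` to `x 1` and `x 4` is undetermined. -/
theorem exists_coloring_of_fiveThree (hG : G.Connected) (hcub : ∀ v, (G.nbr v).card = 3)
    (hc : G.IsShortestCycle c 5) (hx : G.IsPendants c 5 x) (hnot : ∀ i, ¬G.Adj (x i) (x (i + 2)))
    (h14 : ¬G.square.Adj (x 4) (x 1)) : ∃ c : V → Fin 8, G.IsDistanceTwoColoring c := by
  classical
  have hdeg : ∀ v, (G.nbr v).card ≤ 3 := fun v => (hcub v).le
  have e5 : ∀ {i j : ℕ}, i < j → j < 5 → G.square.Adj (c j) (c i) := hc.square_adj_of_length_five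
  have s00 := hx.square_adj_self 0
  have s01 := IsPendants.square_adj_succ hc hx 0
  have s04 := IsPendants.square_adj_pred hc hx 0
  have s11 := hx.square_adj_self 1
  have s12 := IsPendants.square_adj_succ hc hx 1
  have s10 := IsPendants.square_adj_pred hc hx 1
  have s44 := hx.square_adj_self 4
  have s40 := IsPendants.square_adj_succ hc hx 4
  have s43 := IsPendants.square_adj_pred hc hx 4
  have hnot3 : ∀ i, ¬G.Adj (x i) (x (i + 3)) := fun i h => by
    have := hnot (i + 3)
    rw [show i + 3 + 2 = i + 5 by omega, hx.periodic] at this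
    exact this h.symm
  have n2 : ∀ i, ¬G.square.Adj (x i) (c (i + 2)) := fun i h =>
    hnot i ((IsPendants.square_adj_iff hc hx le_rfl le_rfl (by omega)).mp h)
  have n3 : ∀ i, ¬G.square.Adj (x i) (c (i + 3)) := fun i h =>
    hnot3 i ((IsPendants.square_adj_iff hc hx le_rfl (by omega) (by omega)).mp h)
  have s02 := n2 0
  have s03 := n3 0
  have s13 := n2 1
  have s14 := n3 1
  have s41 := n2 4
  have s42 := n3 4
  have c5 : c 5 = c 0 := hc.periodic 0
  have c6 : c 6 = c 1 := hc.periodic 1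
  have c7 : c 7 = c 2 := hc.periodic 2
  have c8 : c 8 = c 3 := hc.periodic 3
  have n01 : x 0 ≠ x 1 := IsPendants.ne hc hx le_rfl (i := 0) (d := 1) (by omega) (by omega)
  have n04 : x 0 ≠ x 4 := IsPendants.ne hc hx le_rfl (i := 0) (d := 4) (by omega) (by omega)
  have n14 : x 1 ≠ x 4 := IsPendants.ne hc hx le_rfl (i := 1) (d := 3) (by omega) (by omega)
  norm_num [c5, c6, c7, c8] at s01 s04 s12 s10 s40 s43 s02 s03 s13 s14 s41 s42
  obtain ⟨a, ha⟩ : ∃ a : Bool, G.square.Adj (x 1) (x 0) ↔ a = true := ⟨_, decide_eq_true_iff.symm⟩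
  obtain ⟨b, hb⟩ : ∃ a : Bool, G.square.Adj (x 4) (x 0) ↔ a = true := ⟨_, decide_eq_true_iff.symm⟩
  have hcheck : ∃ t : List ℕ, t.length = 8 ∧ listCount (edgesOf 8 (fiveThree a b)) t ≠ 0 ∧
      ∀ i : Fin 8, t.getD i 0 + 1 + 9 ≤ (Finset.univ.filter fun j : Fin 8 =>
        j < i ∧ fiveThree a b i j = true ∨ i < j ∧ fiveThree a b j i = true).card + 8 := by
    clear ha hb
    revert a b
    rintro (_ | _) (_ | _)
    · exact ⟨[5, 4, 1, 3, 3, 1, 1, 1], by decide +kernel⟩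
    · exact ⟨[5, 4, 0, 3, 3, 2, 1, 2], by decide +kernel⟩
    · exact ⟨[5, 3, 3, 0, 4, 2, 2, 1], by decide +kernel⟩
    · exact ⟨[5, 4, 0, 3, 3, 3, 1, 2], by decide +kernel⟩
  obtain ⟨t, hcheck⟩ := hcheck
  refine exists_coloring_of_listCount hG hdeg ![c 0, c 1, c 2, c 3, c 4, x 0, x 1, x 4] ?_
    (fiveThree a b) ?_ (fun _ => 9) (fun i => card_square_nbr_le hdeg _) t hcheck 0 1 (hc.adj 0)
  · have hne : ∀ i j, x i ≠ c j := hx.ne_cycle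
    have hne' : ∀ i j, c j ≠ x i := fun i j => (hne i j).symm
    have hcc : ∀ i j, i < j → j < 5 → c i ≠ c j := fun i j h1 h2 => hc.ne i j h1 (by omega)
    intro i j h
    fin_cases i <;> fin_cases j <;>
      first
        | rfl
        | exact absurd h (hne _ _)
        | exact absurd h (hne' _ _)
        | exact absurd h (hcc _ _ (by decide) (by decide))
        | exact absurd h.symm (hcc _ _ (by decide) (by decide))
        | exact absurd h (by assumption)
        | exact absurd h.symm (by assumption)
  · intro i j hij
    fin_cases i <;> fin_cases j <;>
      first
        | exact absurd hij (by decide)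
        | exact iff_of_true (e5 (by decide) (by decide)) rfl
        | exact iff_of_true (by assumption) rfl
        | exact iff_of_false (by assumption) Bool.false_ne_true
        | exact ha
        | exact hb

/-- If every `x i` is adjacent to `x (i + 2)`, then cycle and pendants form a Petersen graph.
Otherwise, in the absence of a coloring, `exists_coloring_of_fiveTwo` passes nonadjacency from the
pair i, i + 2 to the pair i + 2, i + 4, hence to all such pairs, and `exists_coloring_of_fiveThree`
applies. -/
theorem exists_coloring_of_length_five (hG : G.Connected) (hcub : ∀ v, (G.nbr v).card = 3)
    (hpet : ∀ f : Fin 10 → V, Function.Injective f →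
      ¬∀ e ∈ petersenEdges, G.Adj (f e.1) (f e.2)) (hc : G.IsShortestCycle c 5) :
    ∃ c : V → Fin 8, G.IsDistanceTwoColoring c := by
  obtain ⟨x, hx⟩ := hc.exists_isPendants hcub
  have x5 : ∀ i, x (i + 5) = x i := hx.periodic
  have c5 : ∀ i, c (i + 5) = c i := hc.periodic
  by_contra hcol
  have key : ∀ i, ¬G.Adj (x i) (x (i + 2)) → ¬G.Adj (x (i + 2)) (x (i + 4)) ∧
      ¬G.Adj (x i) (x (i + 3)) ∧ ¬G.square.Adj (x (i + 2)) (x i) := by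
    intro i hi
    have hno : ∀ h, False := fun h =>
      hcol (exists_coloring_of_fiveTwo hG hcub (hc.shift i) (hx.shift i) hi h)
    exact ⟨fun h => hno (.inl h), fun h => hno (.inr (.inl h)), fun h => hno (.inr (.inr h))⟩
  by_cases hall : ∀ i, G.Adj (x i) (x (i + 2))
  · refine hpet ![c 0, c 1, c 2, c 3, c 4, x 0, x 1, x 2, x 3, x 4] ?_ ?_
    · have hne : ∀ i j, x i ≠ c j := hx.ne_cycle
      have hne' : ∀ i j, c j ≠ x i := fun i j => (hne i j).symm
      have hcc : ∀ i j, i < j → j < 5 → c i ≠ c j := fun i j h1 h2 => hc.ne i j h1 (by omega)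
      have hxx : ∀ i j, i < j → j < 5 → x i ≠ x j := fun i j h1 h2 => by
        have := IsPendants.ne hc hx le_rfl (i := i) (d := j - i) (by omega) (by omega)
        rwa [Nat.add_sub_cancel' h1.le] at this
      intro i j h
      fin_cases i <;> fin_cases j <;>
        first
          | rfl
          | exact absurd h (hne _ _)
          | exact absurd h (hne' _ _)
          | exact absurd h (hcc _ _ (by decide) (by decide))
          | exact absurd h.symm (hcc _ _ (by decide) (by decide))
          | exact absurd h (hxx _ _ (by decide) (by decide))
          | exact absurd h.symm (hxx _ _ (by decide) (by decide))
    · have h4 := hc.adj 4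
      have h3 := hall 3
      have h2 := hall 4
      rw [show 4 + 1 = 0 + 5 from rfl, c5] at h4
      rw [show 3 + 2 = 0 + 5 from rfl, x5] at h3
      rw [show 4 + 2 = 1 + 5 from rfl, x5] at h2
      intro e he
      simp only [petersenEdges, List.mem_cons, List.not_mem_nil, or_false] at he
      rcases he with rfl | rfl | rfl | rfl | rfl | rfl | rfl | rfl | rfl | rfl | rfl | rfl | rfl |
        rfl | rfl <;>
        first
          | exact hc.adj _
          | exact hx.adj _
          | exact hall _
          | exact h4
          | exact h4.symm
          | exact h3
          | exact h2
  · obtain ⟨j, hj⟩ := not_forall.mp hall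
    have hstep : ∀ d, ¬G.Adj (x (j + 2 * d)) (x (j + 2 * d + 2)) := by
      intro d
      induction d with
      | zero => exact hj
      | succ d ih => exact (key _ ih).1
    have hnot : ∀ i, ¬G.Adj (x i) (x (i + 2)) := by
      intro i h
      have hper : ∀ k r, x (r + 5 * k) = x r := by
        intro k
        induction k with
        | zero => simp
        | succ k ih =>
          intro r
          rw [Nat.mul_succ, ← add_assoc, x5, ih]
      -- Modulo 5 the inverse of 2 is 3 and 4j = -j, so this number of steps of length two leads
      -- from `j` to `i`.
      have := hstep (3 * (i + 4 * j))
      rw [show j + 2 * (3 * (i + 4 * j)) + 2 = (i + 2) + 5 * (i + 5 * j) by ring,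
        show j + 2 * (3 * (i + 4 * j)) = i + 5 * (i + 5 * j) by ring, hper, hper] at this
      exact this h
    refine hcol (exists_coloring_of_fiveThree hG hcub hc hx hnot ?_)
    have := (key 4 (hnot 4)).2.2
    rw [show 4 + 2 = 1 + 5 from rfl, x5] at this
    exact fun h => this h.symm

end IsShortestCycle

end SimpleGraph

/-! ### Shortest cycles of length four -/

namespace SimpleGraph

variable {V : Type*} {G : SimpleGraph V} {c : ℕ → V} {x : ℕ → V}

namespace IsShortestCycle

theorem square_adj_of_length_four (hc : G.IsShortestCycle c 4) {i j : ℕ} (hij : i < j) (hj : j < 4) :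
    G.square.Adj (c j) (c i) := by
  obtain ⟨d, rfl⟩ := Nat.exists_eq_add_of_lt hij
  have hd : d = 0 ∨ d = 1 ∨ d = 2 := by omega
  rcases hd with rfl | rfl | rfl
  · exact (hc.adj i).square.symm
  · exact (square_adj_of_adj_adj (hc.adj i) (hc.adj (i + 1)) (hc.ne _ _ (by omega) (by omega))).symm
  · have := (hc.adj (i + 3)).square
    rwa [show i + 3 + 1 = i + 4 by omega, hc.periodic] at this

variable [Fintype V]

section

variable (hcub : ∀ v, (G.nbr v).card = 3) (hc : G.IsShortestCycle c 4) (hx : G.IsPendants c 4 x)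

include hcub hc hx

/-- One is saved from 9 because `c (i + 2)` is reached through both neighbors on the cycle. The next
two lemmas save one more. -/
theorem card_square_nbr_le_of_length_four (i : ℕ) : (G.square.nbr (c i)).card ≤ 8 := by
  have h1 := hx.eq (i + 1)
  have h3 := hx.eq (i + 3)
  obtain ⟨r, s, hr⟩ := exists_other_nbrs hcub (hx.adj i).symm
  refine card_square_nbr_le_length
    [c (i + 1), c (i + 2), c (i + 3), x i, x (i + 1), x (i + 3), r, s] fun w hw => ?_
  have c4 : c (i + 4) = c i := hc.periodic i
  have c6 : c (i + 6) = c (i + 2) := hc.periodic (i + 2)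
  simp only [add_assoc, Nat.reduceSub, Nat.reduceAdd, c4, c6] at h1 h3
  rcases hx.eq i w hw with rfl | rfl | rfl
  · refine ⟨by simp, fun z hz => ?_⟩
    have := h1 z hz
    simp only [List.mem_cons]
    tauto
  · refine ⟨by simp, fun z hz => ?_⟩
    have := h3 z hz
    simp only [List.mem_cons]
    tauto
  · refine ⟨by simp, fun z hz => ?_⟩
    have := hr z hz
    simp only [List.mem_cons]
    tauto

theorem card_square_nbr_le_of_opposite_eq (i : ℕ) (h : x i = x (i + 2)) :
    (G.square.nbr (c i)).card ≤ 7 := by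
  have h1 := hx.eq (i + 1)
  have h3 := hx.eq (i + 3)
  have hne : c i ≠ c (i + 2) := hc.ne _ _ (by omega) (by omega)
  obtain ⟨r, -, -, -, hr⟩ := exists_third_nbr hcub hne (hx.adj i).symm (h ▸ (hx.adj (i + 2)).symm)
  refine card_square_nbr_le_length
    [c (i + 1), c (i + 2), c (i + 3), x i, x (i + 1), x (i + 3), r] fun w hw => ?_
  have c4 : c (i + 4) = c i := hc.periodic i
  have c6 : c (i + 6) = c (i + 2) := hc.periodic (i + 2)
  simp only [add_assoc, Nat.reduceSub, Nat.reduceAdd, c4, c6] at h1 h3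
  rcases hx.eq i w hw with rfl | rfl | rfl
  · refine ⟨by simp, fun z hz => ?_⟩
    have := h1 z hz
    simp only [List.mem_cons]
    tauto
  · refine ⟨by simp, fun z hz => ?_⟩
    have := h3 z hz
    simp only [List.mem_cons]
    tauto
  · refine ⟨by simp, fun z hz => ?_⟩
    have := hr z hz
    simp only [List.mem_cons]
    tauto

theorem card_square_nbr_le_of_adj_succ (i : ℕ) (h : G.Adj (x i) (x (i + 1))) :
    (G.square.nbr (c i)).card ≤ 7 ∧ (G.square.nbr (c (i + 1))).card ≤ 7 := by
  have h0 := hx.eq i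
  have h1 := hx.eq (i + 1)
  have h2 := hx.eq (i + 2)
  have h3 := hx.eq (i + 3)
  obtain ⟨r, -, -, -, hr⟩ := exists_third_nbr hcub (hx.ne_cycle (i + 1) i).symm (hx.adj i).symm h
  obtain ⟨s, -, -, -, hs⟩ := exists_third_nbr hcub (hx.ne_cycle i (i + 1)).symm
    (hx.adj (i + 1)).symm h.symm
  have c4 : c (i + 4) = c i := hc.periodic i
  have c5 : c (i + 5) = c (i + 1) := hc.periodic (i + 1)
  have c6 : c (i + 6) = c (i + 2) := hc.periodic (i + 2)
  simp only [add_assoc, Nat.reduceSub, Nat.reduceAdd, c4, c5, c6] at h0 h1 h2 h3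
  constructor
  · refine card_square_nbr_le_length
      [c (i + 1), c (i + 2), c (i + 3), x i, x (i + 1), x (i + 3), r] fun w hw => ?_
    rcases h0 w hw with rfl | rfl | rfl
    · refine ⟨by simp, fun z hz => ?_⟩
      have := h1 z hz
      simp only [List.mem_cons]
      tauto
    · refine ⟨by simp, fun z hz => ?_⟩
      have := h3 z hz
      simp only [List.mem_cons]
      tauto
    · refine ⟨by simp, fun z hz => ?_⟩
      have := hr z hz
      simp only [List.mem_cons]
      tauto
  · refine card_square_nbr_le_length
      [c i, c (i + 2), c (i + 3), x i, x (i + 1), x (i + 2), s] fun w hw => ?_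
    rcases h1 w hw with rfl | rfl | rfl
    · refine ⟨by simp, fun z hz => ?_⟩
      have := h2 z hz
      simp only [List.mem_cons]
      tauto
    · refine ⟨by simp, fun z hz => ?_⟩
      have := h0 z hz
      simp only [List.mem_cons]
      tauto
    · refine ⟨by simp, fun z hz => ?_⟩
      have := hs z hz
      simp only [List.mem_cons]
      tauto

end

/-- The complete graph on `m` vertices without the edge between `m` and `k`. -/
def completeBut (m k : ℕ) (i j : ℕ) : Bool := !(i == m && j == k)

theorem exists_coloring_of_fourOne (hG : G.Connected) (hcub : ∀ v, (G.nbr v).card = 3)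
    (hc : G.IsShortestCycle c 4) (hx : G.IsPendants c 4 x) (h02 : ¬G.square.Adj (x 0) (c 2)) :
    ∃ c : V → Fin 8, G.IsDistanceTwoColoring c := by
  have hdeg : ∀ v, (G.nbr v).card ≤ 3 := fun v => (hcub v).le
  have e4 : ∀ {i j : ℕ}, i < j → j < 4 → G.square.Adj (c j) (c i) := hc.square_adj_of_length_four
  have s00 := hx.square_adj_self 0
  have s01 := IsPendants.square_adj_succ hc hx 0
  have s03 := IsPendants.square_adj_pred hc hx 0
  norm_num at s01 s03
  refine exists_coloring_of_listCount hG hdeg ![c 0, c 1, c 2, c 3, x 0] ?_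
    (completeBut 4 2) ?_ ![8, 8, 8, 8, 9] ?_ [1, 2, 2, 3, 1] (by decide +kernel) 0 1 (hc.adj 0)
  · have hne : ∀ i j, x i ≠ c j := hx.ne_cycle
    have hne' : ∀ i j, c j ≠ x i := fun i j => (hne i j).symm
    have hcc : ∀ i j, i < j → j < 4 → c i ≠ c j := fun i j h1 h2 => hc.ne i j h1 (by omega)
    intro i j h
    fin_cases i <;> fin_cases j <;>
      first
        | rfl
        | exact absurd h (hne _ _)
        | exact absurd h (hne' _ _)
        | exact absurd h (hcc _ _ (by decide) (by decide))
        | exact absurd h.symm (hcc _ _ (by decide) (by decide))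
  · intro i j hij
    fin_cases i <;> fin_cases j <;>
      first
        | exact absurd hij (by decide)
        | exact iff_of_true (e4 (by decide) (by decide)) rfl
        | exact iff_of_true (by assumption) rfl
        | exact iff_of_false (by assumption) Bool.false_ne_true
  · have h8 := card_square_nbr_le_of_length_four hcub hc hx
    intro i
    fin_cases i <;>
      first
        | exact h8 _
        | exact card_square_nbr_le hdeg _

theorem exists_coloring_of_fourTwo (hG : G.Connected) (hcub : ∀ v, (G.nbr v).card = 3)
    (hc : G.IsShortestCycle c 4) (hx : G.IsPendants c 4 x) (h02 : G.square.Adj (x 0) (c 2))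
    (h13 : G.square.Adj (x 1) (c 3)) (h01 : ¬G.square.Adj (x 1) (x 0)) :
    ∃ c : V → Fin 8, G.IsDistanceTwoColoring c := by
  have hdeg : ∀ v, (G.nbr v).card ≤ 3 := fun v => (hcub v).le
  have e4 : ∀ {i j : ℕ}, i < j → j < 4 → G.square.Adj (c j) (c i) := hc.square_adj_of_length_four
  have s00 := hx.square_adj_self 0
  have s01 := IsPendants.square_adj_succ hc hx 0
  have s03 := IsPendants.square_adj_pred hc hx 0
  have s11 := hx.square_adj_self 1
  have s12 := IsPendants.square_adj_succ hc hx 1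
  have s10 := IsPendants.square_adj_pred hc hx 1
  have c4 : c 4 = c 0 := hc.periodic 0
  have n01 := IsPendants.ne_succ hc hx le_rfl 0
  norm_num [c4] at s01 s03 s12 s10 n01
  refine exists_coloring_of_listCount hG hdeg ![c 0, c 1, c 2, c 3, x 0, x 1] ?_
    (completeBut 5 4) ?_ ![8, 8, 8, 8, 9, 9] ?_ [1, 2, 3, 4, 2, 2] (by decide +kernel) 0 1
    (hc.adj 0)
  · have hne : ∀ i j, x i ≠ c j := hx.ne_cycle
    have hne' : ∀ i j, c j ≠ x i := fun i j => (hne i j).symm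
    have hcc : ∀ i j, i < j → j < 4 → c i ≠ c j := fun i j h1 h2 => hc.ne i j h1 (by omega)
    intro i j h
    fin_cases i <;> fin_cases j <;>
      first
        | rfl
        | exact absurd h (hne _ _)
        | exact absurd h (hne' _ _)
        | exact absurd h (hcc _ _ (by decide) (by decide))
        | exact absurd h.symm (hcc _ _ (by decide) (by decide))
        | exact absurd h n01
        | exact absurd h.symm n01
  · intro i j hij
    fin_cases i <;> fin_cases j <;>
      first
        | exact absurd hij (by decide)
        | exact iff_of_true (e4 (by decide) (by decide)) rfl
        | exact iff_of_true (by assumption) rfl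
        | exact iff_of_false (by assumption) Bool.false_ne_true
  · have h8 := card_square_nbr_le_of_length_four hcub hc hx
    intro i
    fin_cases i <;>
      first
        | exact h8 _
        | exact card_square_nbr_le hdeg _

/-- The vertices `c 0`, `c 1`, `c 2` keep at least 3, 2, 3 colors, which suffices for a triangle in
the square. -/
theorem exists_coloring_of_opposite_eq (hG : G.Connected) (hcub : ∀ v, (G.nbr v).card = 3)
    (hc : G.IsShortestCycle c 4) (hx : G.IsPendants c 4 x) (h02 : x 0 = x 2) :
    ∃ c : V → Fin 8, G.IsDistanceTwoColoring c := by
  have hdeg : ∀ v, (G.nbr v).card ≤ 3 := fun v => (hcub v).le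
  have e4 : ∀ {i j : ℕ}, i < j → j < 4 → G.square.Adj (c j) (c i) := hc.square_adj_of_length_four
  have h0 := card_square_nbr_le_of_opposite_eq hcub hc hx 0 h02
  have h2 := card_square_nbr_le_of_opposite_eq hcub hc hx 2 (h02.symm.trans (hx.periodic 0).symm)
  have h1 := card_square_nbr_le_of_length_four hcub hc hx 1
  refine exists_coloring_of_listCount hG hdeg ![c 0, c 1, c 2] ?_
    (fun _ _ => true) ?_ ![7, 8, 7] ?_ [0, 1, 2] (by decide +kernel) 0 1 (hc.adj 0)
  · have hcc : ∀ i j, i < j → j < 4 → c i ≠ c j := fun i j h1 h2 => hc.ne i j h1 (by omega)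
    intro i j h
    fin_cases i <;> fin_cases j <;>
      first
        | rfl
        | exact absurd h (hcc _ _ (by decide) (by decide))
        | exact absurd h.symm (hcc _ _ (by decide) (by decide))
  · intro i j hij
    fin_cases i <;> fin_cases j <;>
      first
        | exact absurd hij (by decide)
        | exact iff_of_true (e4 (by decide) (by decide)) rfl
  · intro i
    fin_cases i
    · exact h0
    · exact h1
    · exact h2

theorem exists_coloring_of_pendants_adj (hG : G.Connected) (hcub : ∀ v, (G.nbr v).card = 3)
    (hc : G.IsShortestCycle c 4) (hx : G.IsPendants c 4 x) (h01 : G.Adj (x 0) (x 1)) :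
    ∃ c : V → Fin 8, G.IsDistanceTwoColoring c := by
  have hdeg : ∀ v, (G.nbr v).card ≤ 3 := fun v => (hcub v).le
  have h7 := card_square_nbr_le_of_adj_succ hcub hc hx 0 h01
  have hc01 := hc.adj 0
  refine exists_coloring_of_listCount hG hdeg ![c 0, c 1] ?_
    (fun _ _ => true) ?_ ![7, 7] ?_ [0, 1] (by decide +kernel) 0 1 (hc.adj 0)
  · intro i j h
    have := hc01.ne
    fin_cases i <;> fin_cases j <;> simp_all
  · have := hc01.square
    intro i j hij
    fin_cases i <;> fin_cases j <;> simp_all [G.square.adj_comm]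
  · intro i
    fin_cases i
    · exact h7.1
    · exact h7.2

/-- Without a coloring, the reducible sets above force `x i` to be adjacent to `x (i + 2)`, and
consecutive pendants to be nonadjacent with a common neighbor. For `x 0` this must be its third
neighbor `z`, with `x 1` as well as with `x 3`, so `z`, `x 1`, `x 3` form a triangle. -/
theorem exists_coloring_of_length_four (hG : G.Connected) (hcub : ∀ v, (G.nbr v).card = 3)
    (hc : G.IsShortestCycle c 4) : ∃ c : V → Fin 8, G.IsDistanceTwoColoring c := by
  obtain ⟨x, hx⟩ := hc.exists_isPendants hcub
  by_contra hcol
  have hsq : ∀ i, G.square.Adj (x i) (c (i + 2)) := by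
    intro i
    by_contra h
    exact hcol (exists_coloring_of_fourOne hG hcub (hc.shift i) (hx.shift i) h)
  have hopp : ∀ i, x i ≠ x (i + 2) := fun i h =>
    hcol (exists_coloring_of_opposite_eq hG hcub (hc.shift i) (hx.shift i) h)
  have hsucc : ∀ i, ¬G.Adj (x i) (x (i + 1)) := fun i h =>
    hcol (exists_coloring_of_pendants_adj hG hcub (hc.shift i) (hx.shift i) h)
  have hpair : ∀ i, G.square.Adj (x (i + 1)) (x i) := by
    intro i
    by_contra h
    exact hcol (exists_coloring_of_fourTwo hG hcub (hc.shift i) (hx.shift i) (hsq i)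
      (hsq (i + 1)) h)
  have x4 : ∀ i, x (i + 4) = x i := hx.periodic
  have c4 : ∀ i, c (i + 4) = c i := hc.periodic
  have honly : ∀ i d, 1 ≤ d → d < 4 → ¬G.Adj (c (i + d)) (x i) := by
    intro i d h1 hd h
    obtain rfl | rfl | rfl : d = 1 ∨ d = 2 ∨ d = 3 := by omega
    · rcases hx.eq _ _ h with h | h | h
      · exact hx.ne_cycle _ _ h
      · exact hx.ne_cycle _ _ h
      · exact IsPendants.ne_succ hc hx le_rfl i h
    · rcases hx.eq _ _ h with h | h | h
      · exact hx.ne_cycle _ _ h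
      · exact hx.ne_cycle _ _ h
      · exact hopp i h
    · rcases hx.eq _ _ h with h | h | h
      · exact hx.ne_cycle _ _ h
      · exact hx.ne_cycle _ _ h
      · have := IsPendants.ne_succ hc hx le_rfl (i + 3)
        rw [show i + 3 + 1 = i + 4 by omega, x4] at this
        exact this h.symm
  have hxx : ∀ i, G.Adj (x i) (x (i + 2)) := by
    intro i
    rcases hsq i with h | ⟨-, w, h1, h2⟩
    · exact absurd h.symm (honly i 2 (by omega) (by omega))
    · rcases hx.eq _ _ h2.symm with rfl | rfl | rfl
      · exact absurd h1.symm (honly i 3 (by omega) (by omega))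
      · rw [show i + 2 + (4 - 1) = i + 1 + 4 by omega, c4] at h1
        exact absurd h1.symm (honly i 1 (by omega) (by omega))
      · exact h1
  obtain ⟨z, -, -, -, hz⟩ := exists_third_nbr hcub (hx.ne_cycle 2 0).symm (hx.adj 0).symm (hxx 0)
  have hz1 : G.Adj z (x 1) := by
    rcases hpair 0 with h | ⟨-, w, h1, h2⟩
    · exact absurd h.symm (hsucc 0)
    · rcases hz w h2.symm with rfl | rfl | rfl
      · have := honly 1 3 (by omega) (by omega)
        rw [show 1 + 3 = 0 + 4 from rfl, c4] at this
        exact absurd h1.symm this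
      · exact absurd h1 (hsucc 1)
      · exact h1.symm
  have hz3 : G.Adj z (x 3) := by
    have h30 := hpair 3
    rw [show 3 + 1 = 0 + 4 from rfl, x4] at h30
    rcases h30 with h | ⟨-, w, h1, h2⟩
    · have := hsucc 3
      rw [show 3 + 1 = 0 + 4 from rfl, x4] at this
      exact absurd h.symm this
    · rcases hz w h1 with rfl | rfl | rfl
      · have := honly 3 1 (by omega) (by omega)
        rw [show 3 + 1 = 0 + 4 from rfl, c4] at this
        exact absurd h2 this
      · exact absurd h2 (hsucc 2)
      · exact h2
  exact hc.not_triangle le_rfl hz1 hz3 (hxx 1)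

end IsShortestCycle

end SimpleGraph

/-! ### The connected case and the theorem -/

namespace SimpleGraph

section

variable {V : Type*} {G : SimpleGraph V} [Fintype V]

theorem exists_isShortestCycle [Nontrivial V] (hG : G.Connected)
    (hcub : ∀ v, (G.nbr v).card = 3) : ∃ c n, G.IsShortestCycle c n := by
  classical
  have hex : ∃ n c, G.IsPeriodicCycle c n := by
    -- A nontrivial finite tree has a leaf, which a cubic graph does not.
    have hac : ¬G.IsAcyclic := by
      intro h
      obtain ⟨v, hv⟩ := IsTree.exists_vert_degree_one_of_nontrivial ⟨hG, h⟩
      have := hcub v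
      rw [show G.nbr v = G.neighborFinset v by ext; simp, card_neighborFinset_eq_degree, hv] at this
      omega
    rw [IsAcyclic] at hac
    push Not at hac
    obtain ⟨v, w, hw⟩ := hac
    exact ⟨_, _, exists_isPeriodicCycle_of_isCycle w hw⟩
  obtain ⟨c, hc⟩ := Nat.find_spec hex
  exact ⟨c, _, hc, fun m c' h => Nat.find_min' hex ⟨c', h⟩⟩

/-- A connected graph with maximum degree at most three that does not contain the Petersen graph
has a distance-2 coloring with eight colors. -/
theorem Connected.exists_coloring (hG : G.Connected) (hdeg : ∀ v, (G.nbr v).card ≤ 3)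
    (hpet : ∀ f : Fin 10 → V, Function.Injective f →
      ¬∀ e ∈ petersenEdges, G.Adj (f e.1) (f e.2)) :
    ∃ c : V → Fin 8, G.IsDistanceTwoColoring c := by
  rcases subsingleton_or_nontrivial V with hV | hV
  · exact ⟨fun _ => 0, fun v w h => absurd (Subsingleton.elim v w) (G.square.ne_of_adj h)⟩
  by_cases hcub : ∀ v, (G.nbr v).card = 3
  · obtain ⟨c, n, hc⟩ := exists_isShortestCycle hG hcub
    have h3 := hc.three_le
    rcases Nat.lt_or_ge n 7 with hn | hn
    · interval_cases n
      · refine exists_coloring_of_triangle hG hcub (hc.adj 0) ?_ (hc.adj 1)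
        have := hc.adj 2
        rw [show 2 + 1 = 0 + 3 from rfl, hc.periodic] at this
        exact this.symm
      · exact hc.exists_coloring_of_length_four hG hcub
      · exact hc.exists_coloring_of_length_five hG hcub hpet
      · exact hc.exists_coloring_of_length_six hG hcub rfl
    · exact exists_coloring_of_long_cycle hG hcub hc hn
  · obtain ⟨v, hv⟩ := not_forall.mp hcub
    obtain ⟨u, hu⟩ := hG.preconnected.exists_adj_of_nontrivial v
    exact exists_coloring_of_card_nbr_le_two hG hdeg (by have := hdeg v; omega) hu

end

end SimpleGraph

theorem mainTheorem1 {V : Type*} [Fintype V] (G : SimpleGraph V) [DecidableRel G.Adj]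
    (hplanar : G.IsPlanar) (hdeg : ∀ v : V, G.degree v ≤ 3) :
    ∃ c : V → Fin 8, G.IsDistanceTwoColoring c := by
  classical
  have hcomp : ∀ C : G.ConnectedComponent, ∃ c : C → Fin 8, C.toSimpleGraph.IsDistanceTwoColoring c := by
    intro C
    refine C.connected_toSimpleGraph.exists_coloring (fun v => ?_) fun f hf h =>
      hplanar.not_petersen (fun i => (f i : V)) (Subtype.val_injective.comp hf)
        fun e he => C.toSimpleGraph_hom.map_adj (h e he)
    refine le_trans ?_ (hdeg v)
    rw [← SimpleGraph.card_neighborFinset_eq_degree, ← Finset.card_map (Function.Embedding.subtype _)]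
    refine Finset.card_le_card fun w hw => ?_
    obtain ⟨w, hw', rfl⟩ := Finset.mem_map.mp hw
    exact (G.mem_neighborFinset _ _).mpr (C.toSimpleGraph_hom.map_adj (SimpleGraph.mem_nbr.mp hw'))
  choose c hc using hcomp
  refine ⟨fun v => c (G.connectedComponentMk v) ⟨v, rfl⟩, ?_⟩
  -- This allows adjacent vertices of the square to be compared in one and the same component.
  have hval : ∀ (C : G.ConnectedComponent) (v : V) (hv : v ∈ C),
      c (G.connectedComponentMk v) ⟨v, rfl⟩ = c C ⟨v, hv⟩ := by
    rintro C v rfl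
    rfl
  intro v w hvw
  have hw : w ∈ G.connectedComponentMk v := by
    rcases hvw with h | ⟨-, u, hvu, huw⟩
    · exact SimpleGraph.ConnectedComponent.sound h.symm.reachable
    · exact SimpleGraph.ConnectedComponent.sound (hvu.reachable.trans huw.reachable).symm
  dsimp only
  rw [hval _ w hw]
  refine hc _ _ _ ?_
  rcases hvw with h | ⟨hne, u, hvu, huw⟩
  · exact Or.inl h
  · refine Or.inr ⟨fun h => hne (Subtype.ext_iff.mp h), ⟨u, ?_⟩, hvu, huw⟩
    exact SimpleGraph.ConnectedComponent.sound hvu.symm.reachable
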